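/- Let $d\ge 1$ be an integer and $\gamma>0$. For $\beta>-1$ let $\eta_{d,\beta,\gamma}$ be a Poisson point process on $\mathbb{R}^d\times[0,\infty)$ whose intensity measure has density $$(v,h)\mapsto \gamma\, c_{d+1,\beta}\, h^{\beta},\qquad c_{d+1,\beta}=\frac{\Gamma\left(\frac{d+1}{2}+\beta+1\right)}{\pi^{\frac{d+1}{2}}\,\Gamma(\beta+1)},$$ with respect to Lebesgue measure on $\mathbb{R}^d\times[0,\infty)$. Let $r(d)=\Gamma\left(\frac{d+1}{2}\right)\pi^{-\frac{d+1}{2}}$, and let $\eta_{d,-1,\gamma}$ be a Poisson point process on $\mathbb{R}^d\times[0,\infty)$ whose intensity measure is $r(d)\gamma$ times the $d$-dimensional Lebesgue measure on $\mathbb{R}^d\times\{0\}$. These Poisson processes exist, and, as $\beta\downarrow-1$, $\eta_{d,\beta,\gamma}$ converges in distribution to $\eta_{d,-1,\gamma}$; that is, the laws converge weakly on the space of locally finite integer-valued measures on $\mathbb{R}^d\times[0,\infty)$, endowed with the vague topology (the coarsest topology for which $\mu\mapsto\int f\,d\mu$ is continuous for every continuous $f\ge 0$ with compact support) and its Borel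 $\sigma$-algebra. -/

import Mathlib

open MeasureTheory ProbabilityTheory Filter Topology
open scoped NNReal ENNReal

noncomputable section

/-- A point measure on `S`: a locally finite Borel measure all of whose values are
non-negative integers or `∞`. -/
@[ext]
structure PointMeasure (S : Type*) [TopologicalSpace S] [MeasurableSpace S] where
  /-- The underlying measure. -/
  toMeasure : Measure S
  locallyFinite : IsLocallyFiniteMeasure toMeasure
  integerValued : ∀ B : Set S, MeasurableSet B → ∃ n : ℕ∞, toMeasure B = (n : ℝ≥0∞)

namespace PointMeasure

variable {S : Type*} [TopologicalSpace S] [MeasurableSpace S]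

/-- The vague topology: the coarsest topology for which all the maps `μ ↦ ∫ f dμ` are continuous,
where `f` runs through the non-negative continuous functions with compact support. -/
instance : TopologicalSpace (PointMeasure S) :=
  ⨅ f : CompactlySupportedContinuousMap S ℝ≥0,
    TopologicalSpace.induced
      (fun μ : PointMeasure S => ∫⁻ x, (f x : ℝ≥0∞) ∂μ.toMeasure) inferInstance

/-- The Borel σ-algebra of the vague topology. -/
instance : MeasurableSpace (PointMeasure S) := borel (PointMeasure S)

instance : BorelSpace (PointMeasure S) := ⟨rfl⟩

end PointMeasure

/-- The random point measure `η`, defined on the probability space `(Ω, P)`, is a Poisson point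
process on `S` with intensity measure `Λ`: the number of points in a measurable set `B` is Poisson
distributed with parameter `Λ B` (almost surely infinite if `Λ B = ∞`), and the numbers of points
in pairwise disjoint measurable sets are independent. -/
structure IsPoissonProcess {S Ω : Type*} [TopologicalSpace S] [MeasurableSpace S]
    [MeasurableSpace Ω] (η : Ω → PointMeasure S) (Λ : Measure S) (P : Measure Ω) : Prop where
  measurable : Measurable η
  hasLaw_count : ∀ B : Set S, MeasurableSet B → Λ B ≠ ∞ →
    HasLaw (fun ω => (η ω).toMeasure B)
      ((poissonMeasure (Λ B).toNNReal).map (fun n : ℕ => (n : ℝ≥0∞))) P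
  count_eq_top : ∀ B : Set S, MeasurableSet B → Λ B = ∞ → ∀ᵐ ω ∂P, (η ω).toMeasure B = ∞
  iIndepFun_count : ∀ (n : ℕ) (B : Fin n → Set S), (∀ i, MeasurableSet (B i)) →
    Pairwise (fun i j => Disjoint (B i) (B j)) →
    iIndepFun (fun (i : Fin n) (ω : Ω) => (η ω).toMeasure (B i)) P

/-- The space `ℝ^d × [0, ∞)`. -/
abbrev HalfSpace (d : ℕ) : Type := EuclideanSpace ℝ (Fin d) × ℝ≥0

/-- Lebesgue measure on `ℝ^d × [0, ∞)`. -/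
def lebesgueHalfSpace (d : ℕ) : Measure (HalfSpace d) :=
  (volume : Measure (EuclideanSpace ℝ (Fin d))).prod
    ((volume : Measure ℝ).comap (fun h : ℝ≥0 => (h : ℝ)))

/-- The constant `c_{d+1,β} = Γ((d+1)/2 + β + 1) / (π^{(d+1)/2} Γ(β+1))`. -/
def betaConst (d : ℕ) (β : ℝ) : ℝ :=
  Real.Gamma (((d : ℝ) + 1) / 2 + β + 1) /
    (Real.pi ^ (((d : ℝ) + 1) / 2) * Real.Gamma (β + 1))

/-- The measure on `ℝ^d × [0, ∞)` with Lebesgue density `(v, h) ↦ γ c_{d+1,β} h^β`. -/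
def betaIntensity (d : ℕ) (β γ : ℝ) : Measure (HalfSpace d) :=
  (lebesgueHalfSpace d).withDensity
    (fun x => ENNReal.ofReal (γ * betaConst d β * (x.2 : ℝ) ^ β))

/-- The constant `r(d) = Γ((d+1)/2) π^{-(d+1)/2}`. -/
def rConst (d : ℕ) : ℝ :=
  Real.Gamma (((d : ℝ) + 1) / 2) * Real.pi ^ (-(((d : ℝ) + 1) / 2))

/-- `r(d) γ` times the Lebesgue measure on `ℝ^d × {0}`, as a measure on `ℝ^d × [0, ∞)`. -/
def limitIntensity (d : ℕ) (γ : ℝ) : Measure (HalfSpace d) :=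
  ENNReal.ofReal (rConst d * γ) •
    (volume : Measure (EuclideanSpace ℝ (Fin d))).map (fun v => ((v, 0) : HalfSpace d))

end

/-! All the processes are built from one unit-rate Poisson process `N` on the half-space. Write `p =
β + 1` and `C = γ c_{d+1,β} / (β + 1)`. The beta intensity gives the heights `[0, x]` the mass `C x
^ p` per unit volume of `ℝ^d`, so moving each point of `N` from height `u` to `(u / C) ^ (1 / p)`
produces a Poisson process with that intensity (`map_heightScale`, `IsPoissonProcess.mapOn`).

As `β ↓ -1`, `p → 0` and, by `Γ(β + 2) = (β + 1) Γ(β + 1)`, `C → c = r(d) γ`. A point with `u < c`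
then falls to height `0`, while one with `u > c` leaves every compact set. Almost surely `N` has no
point at height exactly `c`, so the moved processes converge vaguely to the points of `N` below
height `c` projected to height `0`; this is a Poisson process with the limit intensity
(`tendsto_heightMap`). Almost sure convergence of the coupled copies gives convergence of the laws.

Two general facts support the coupling. Existence (`exists_isPoissonProcess`): superpose independent
mixed binomial processes on bounded annuli. Uniqueness in law (`IsPoissonProcess.map_eq`):
independence on disjoint sets fixes all finite-dimensional count laws, and the counts generate the
vague Borel σ-algebra. Uniqueness lets the coupled copies replace arbitrary realizations. -/

namespace PointMeasure

/-! ### The vague topology and its Borel σ-algebra. -/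

section Topology

variable {S : Type*} [TopologicalSpace S] [MeasurableSpace S]

lemma continuous_lintegral (f : CompactlySupportedContinuousMap S ℝ≥0) :
    Continuous fun μ : PointMeasure S => ∫⁻ x, (f x : ℝ≥0∞) ∂μ.toMeasure :=
  continuous_iff_le_induced.2 (iInf_le _ f)

lemma tendsto_nhds_iff {ι : Type*} {l : Filter ι} {η : ι → PointMeasure S} {μ : PointMeasure S} :
    Tendsto η l (𝓝 μ) ↔ ∀ f : CompactlySupportedContinuousMap S ℝ≥0,
      Tendsto (fun i => ∫⁻ x, (f x : ℝ≥0∞) ∂(η i).toMeasure) l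
        (𝓝 (∫⁻ x, (f x : ℝ≥0∞) ∂μ.toMeasure)) := by
  simp only [nhds_iInf, tendsto_iInf, nhds_induced, tendsto_comap_iff, Function.comp_def]

lemma measurable_coe_testFunction [OpensMeasurableSpace S]
    (f : CompactlySupportedContinuousMap S ℝ≥0) : Measurable fun x => (f x : ℝ≥0∞) :=
  f.continuous.measurable.coe_nnreal_ennreal

lemma lintegral_lt_top [OpensMeasurableSpace S] (μ : PointMeasure S)
    (f : CompactlySupportedContinuousMap S ℝ≥0) :
    ∫⁻ x, (f x : ℝ≥0∞) ∂μ.toMeasure < ∞ := by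
  have := μ.locallyFinite
  have hc : Continuous fun x => (f x : ℝ) := NNReal.continuous_coe.comp f.continuous
  have hs : HasCompactSupport fun x => (f x : ℝ) :=
    f.hasCompactSupport.comp_left (g := fun y : ℝ≥0 => (y : ℝ)) rfl
  have h := (hc.integrable_of_hasCompactSupport hs (μ := μ.toMeasure)).lintegral_lt_top
  simpa only [ENNReal.ofReal_coe_nnreal] using h

end Topology

/-- Countably many test functions control the integrals of all test functions. -/
lemma exists_countable_testFunctions {S : Type*} [MetricSpace S] [ProperSpace S]
    [Nonempty S] :
    ∃ D : ℕ × ℕ → CompactlySupportedContinuousMap S ℝ≥0,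
      ∀ f : CompactlySupportedContinuousMap S ℝ≥0, ∃ j, ∀ δ : ℝ≥0, 0 < δ → ∃ i, ∀ x,
        f x ≤ D i x + δ * D j x ∧ D i x ≤ f x + δ * D j x := by
  obtain ⟨x₀⟩ := ‹Nonempty S›
  -- Cutoffs equal to `1` on the ball of radius `n` and to `0` outside that of radius `n + 1`. Their
  -- products with a compact-open dense sequence form the countable family.
  let g : ℕ → C(S, ℝ≥0) := fun n => ⟨fun x => min 1 (Real.toNNReal (n + 1 - dist x x₀)),
    by fun_prop⟩
  have hg1 : ∀ (n : ℕ) x, dist x x₀ ≤ n → g n x = 1 := by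
    intro n x hx
    simp only [g, ContinuousMap.coe_mk, min_eq_left_iff]
    rw [Real.one_le_toNNReal]
    linarith
  have hg0 : ∀ (n : ℕ) x, x ∉ Metric.closedBall x₀ (n + 1) → g n x = 0 := by
    intro n x hx
    rw [Metric.mem_closedBall, not_le] at hx
    have : Real.toNNReal (n + 1 - dist x x₀) = 0 := Real.toNNReal_of_nonpos (by linarith)
    simp [g, this]
  let D : ℕ × ℕ → CompactlySupportedContinuousMap S ℝ≥0 := fun p =>
    ⟨g p.1 * TopologicalSpace.denseSeq C(S, ℝ≥0) p.2,
      HasCompactSupport.intro (isCompact_closedBall x₀ (p.1 + 1)) fun x hx => by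
        simp [hg0 p.1 x hx]⟩
  have hD : ∀ n k x, D (n, k) x = g n x * TopologicalSpace.denseSeq C(S, ℝ≥0) k x :=
    fun n k x => rfl
  have happrox : ∀ (n : ℕ) (f : C(S, ℝ≥0)) (δ : ℝ≥0), 0 < δ → ∃ k, ∀ x,
      dist x x₀ ≤ n + 1 → dist (f x) (TopologicalSpace.denseSeq C(S, ℝ≥0) k x) < δ := by
    intro n f δ hδ
    have h := (ContinuousMap.tendsto_iff_forall_isCompact_tendstoUniformlyOn.1
      (tendsto_id (α := C(S, ℝ≥0)) (x := 𝓝 f))) _ (isCompact_closedBall x₀ (n + 1))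
    have h' := Metric.tendstoUniformlyOn_iff.1 h δ (by exact_mod_cast hδ)
    obtain ⟨k, he⟩ := (TopologicalSpace.denseRange_denseSeq C(S, ℝ≥0)).exists_mem_open
      isOpen_interior ⟨f, mem_interior_iff_mem_nhds.2 h'⟩
    exact ⟨k, fun x hx => interior_subset he x (Metric.mem_closedBall.2 hx)⟩
  refine ⟨D, fun f => ?_⟩
  obtain ⟨n, hn⟩ : ∃ n : ℕ, ∀ x, f x ≠ 0 → dist x x₀ ≤ n := by
    obtain ⟨r, hr⟩ := f.hasCompactSupport.isCompact.isBounded.subset_closedBall x₀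
    obtain ⟨n, hn⟩ := exists_nat_ge r
    exact ⟨n, fun x hx => (Metric.mem_closedBall.1 (hr (subset_tsupport _ hx))).trans hn⟩
  -- A dense function within `1` of the constant `2` is at least `1` on the larger ball, so `D (n,
  -- k)` dominates the cutoff `g n` and can serve as error envelope.
  obtain ⟨k, hk⟩ := happrox n (ContinuousMap.const S 2) 1 one_pos
  refine ⟨(n, k), fun δ hδ => ?_⟩
  obtain ⟨i, hi⟩ := happrox n f.toContinuousMap δ hδ
  refine ⟨(n, i), fun x => ?_⟩
  simp only [hD]
  by_cases hx : dist x x₀ ≤ n + 1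
  · have h1 := hk x hx
    have h2 := hi x hx
    rw [NNReal.dist_eq, abs_lt] at h1 h2
    have hfg : f x = g n x * f x := by
      by_cases h0 : f x = 0
      · simp [h0]
      · rw [hg1 n x (hn x h0), one_mul]
    have h3 : (1 : ℝ) ≤ TopologicalSpace.denseSeq C(S, ℝ≥0) k x := by
      have := h1.2
      simp only [ContinuousMap.const_apply] at this
      push_cast at this
      linarith
    have h2' : |(f x : ℝ) - TopologicalSpace.denseSeq C(S, ℝ≥0) i x| < δ := abs_lt.2 h2
    rw [abs_lt] at h2'
    have hb : (δ : ℝ) ≤ δ * TopologicalSpace.denseSeq C(S, ℝ≥0) k x :=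
      le_mul_of_one_le_right δ.2 h3
    have hgn : (0 : ℝ) ≤ g n x := (g n x).2
    constructor
    · rw [hfg, ← NNReal.coe_le_coe]
      push_cast
      nlinarith
    · nth_rewrite 1 [hfg]
      rw [← NNReal.coe_le_coe]
      push_cast
      nlinarith
  · have h0 : g n x = 0 := hg0 n x fun h => hx (Metric.mem_closedBall.1 h)
    have hf0 : f x = 0 := by
      by_contra h
      exact hx ((hn x h).trans (by linarith))
    simp [h0, hf0]

section Metric

variable {S : Type*} [MetricSpace S] [ProperSpace S] [MeasurableSpace S] [BorelSpace S]

/-- Exhaust `U` by compact sets `K n` and squeeze a test function between the indicators of `K n`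
and `U`: the count is then a countable supremum of vaguely continuous maps. -/
lemma measurable_count_of_isOpen {U : Set S} (hU : IsOpen U) :
    Measurable fun μ : PointMeasure S => μ.toMeasure U := by
  rcases isEmpty_or_nonempty S with hS | ⟨⟨x₀⟩⟩
  · have : U = ∅ := Set.eq_empty_of_isEmpty U
    simp [this]
  obtain ⟨F, hFc, hFU, hFun, hFm⟩ := hU.exists_iUnion_isClosed
  let K : ℕ → Set S := fun n => F n ∩ Metric.closedBall x₀ n
  have hK : ∀ n, IsCompact (K n) := fun n => (isCompact_closedBall x₀ n).inter_left (hFc n)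
  have hKm : Monotone K := fun m n hmn => Set.inter_subset_inter (hFm hmn)
    (Metric.closedBall_subset_closedBall (by exact_mod_cast hmn))
  have hKU : ∀ n, K n ⊆ U := fun n => Set.inter_subset_left.trans (hFU n)
  have hKun : ⋃ n, K n = U := by
    refine Set.Subset.antisymm (Set.iUnion_subset hKU) fun x hx => ?_
    rw [← hFun] at hx
    obtain ⟨n, hn⟩ := Set.mem_iUnion.1 hx
    obtain ⟨m, hm⟩ := exists_nat_ge (dist x x₀)
    refine Set.mem_iUnion.2 ⟨max n m, hFm (le_max_left _ _) hn, ?_⟩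
    rw [Metric.mem_closedBall]
    exact hm.trans (by exact_mod_cast le_max_right n m)
  have hf : ∀ n, ∃ f : CompactlySupportedContinuousMap S ℝ≥0,
      (∀ x ∈ K n, f x = 1) ∧ (∀ x, f x ≤ 1) ∧ ∀ x, x ∉ U → f x = 0 := by
    intro n
    obtain ⟨g, hg1, hgc, hgU, hg01⟩ :=
      exists_continuousMap_one_of_isCompact_subset_isOpen (hK n) hU (hKU n)
    refine ⟨⟨⟨fun x => (g x).toNNReal, by fun_prop⟩,
      HasCompactSupport.comp_left (g := Real.toNNReal) hgc Real.toNNReal_zero⟩, ?_, ?_, ?_⟩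
    · intro x hx
      simp [CompactlySupportedContinuousMap.coe_mk, hg1 hx]
    · intro x
      simpa using (hg01 x).2
    · intro x hx
      have : g x = 0 := image_eq_zero_of_notMem_tsupport fun h => hx (hgU h)
      simp [this]
  choose f hf1 hfle hf0 using hf
  have key : ∀ μ : PointMeasure S,
      μ.toMeasure U = ⨆ n, ∫⁻ x, (f n x : ℝ≥0∞) ∂μ.toMeasure := by
    intro μ
    refine le_antisymm ?_ (iSup_le fun n => ?_)
    · rw [← hKun, hKm.measure_iUnion]
      refine iSup_mono fun n => ?_
      rw [← lintegral_indicator_one (hK n).measurableSet]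
      refine lintegral_mono fun x => ?_
      by_cases hx : x ∈ K n
      · simp [hx, hf1 n x hx]
      · simp [hx]
    · rw [← lintegral_indicator_one hU.measurableSet]
      refine lintegral_mono fun x => ?_
      by_cases hx : x ∈ U
      · simpa [hx] using hfle n x
      · simp [hx, hf0 n x hx]
  simp_rw [key]
  exact Measurable.iSup fun n => (continuous_lintegral (f n)).measurable

/-- The number of points in a measurable set is measurable for the vague Borel σ-algebra. -/
lemma measurable_count {B : Set S} (hB : MeasurableSet B) :
    Measurable fun μ : PointMeasure S => μ.toMeasure B := by
  rcases isEmpty_or_nonempty S with hS | ⟨⟨x₀⟩⟩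
  · have : B = ∅ := Set.eq_empty_of_isEmpty B
    simp [this]
  have hfin : ∀ (n : ℕ) (μ : PointMeasure S),
      IsFiniteMeasure (μ.toMeasure.restrict (Metric.ball x₀ n)) := by
    intro n μ
    have := μ.locallyFinite
    exact ⟨by simpa using Metric.isBounded_ball.measure_lt_top⟩
  -- Restricting to balls makes the measures finite, so that the π-system of open sets suffices.
  have hres : ∀ n : ℕ,
      Measurable fun μ : PointMeasure S => μ.toMeasure.restrict (Metric.ball x₀ n) := by
    intro n
    refine Measurable.measure_of_isPiSystem (S := {s : Set S | IsOpen s})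
      BorelSpace.measurable_eq (fun s hs t ht _ => hs.inter ht) (fun s hs => ?_) ?_
    · simp_rw [Measure.restrict_apply hs.measurableSet]
      exact measurable_count_of_isOpen (hs.inter Metric.isOpen_ball)
    · simp_rw [Measure.restrict_apply MeasurableSet.univ]
      exact measurable_count_of_isOpen (isOpen_univ.inter Metric.isOpen_ball)
  have hmono : Monotone fun n : ℕ => B ∩ Metric.ball x₀ n := fun m n hmn =>
    Set.inter_subset_inter_right _ (Metric.ball_subset_ball (by exact_mod_cast hmn))
  have key : ∀ μ : PointMeasure S,
      μ.toMeasure B = ⨆ n : ℕ, μ.toMeasure.restrict (Metric.ball x₀ n) B := by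
    intro μ
    simp_rw [Measure.restrict_apply hB]
    rw [← hmono.measure_iUnion, ← Set.inter_iUnion, Metric.iUnion_ball_nat, Set.inter_univ]
  simp_rw [key]
  exact Measurable.iSup fun n => (Measure.measurable_coe hB).comp (hres n)

/-- A random point measure is measurable as soon as all its counts are. -/
lemma measurable_of_count {Ω : Type*} [MeasurableSpace Ω] {η : Ω → PointMeasure S}
    (h : ∀ B, MeasurableSet B → Measurable fun ω => (η ω).toMeasure B) : Measurable η := by
  rcases isEmpty_or_nonempty S with hS | hS
  · have : Subsingleton (PointMeasure S) := ⟨fun μ ν => PointMeasure.ext (Subsingleton.elim _ _)⟩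
    exact measurable_of_subsingleton_codomain η
  have hη : Measurable fun ω => (η ω).toMeasure := Measure.measurable_of_measurable_coe _ h
  obtain ⟨D, hD⟩ := exists_countable_testFunctions (S := S)
  let Φ : PointMeasure S → ℕ × ℕ → ℝ≥0∞ := fun μ i => ∫⁻ x, (D i x : ℝ≥0∞) ∂μ.toMeasure
  have hΦ : Measurable fun ω => Φ (η ω) := measurable_pi_lambda _ fun i =>
    (Measure.measurable_lintegral (measurable_coe_testFunction (D i))).comp hη
  -- Countably many integrals already induce a topology at least as fine as the vague one. Hence
  -- each vaguely open set is a `Φ`-preimage of an open set in a second countable product, where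
  -- open sets are measurable.
  have hle : TopologicalSpace.induced Φ inferInstance ≤
      (inferInstance : TopologicalSpace (PointMeasure S)) := by
    refine le_iInf fun f => ?_
    rw [← continuous_iff_le_induced]
    let t : TopologicalSpace (PointMeasure S) := TopologicalSpace.induced Φ inferInstance
    have hc : ∀ i, Continuous fun μ : PointMeasure S => ∫⁻ x, (D i x : ℝ≥0∞) ∂μ.toMeasure :=
      fun i => (continuous_apply i).comp (continuous_induced_dom (f := Φ))
    obtain ⟨j, hj⟩ := hD f
    refine continuous_iff_continuousAt.2 fun μ₀ => ?_
    have hI : ∀ (δ : ℝ≥0) (u v : CompactlySupportedContinuousMap S ℝ≥0),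
        (∀ x, u x ≤ v x + δ * D j x) → ∀ μ : PointMeasure S,
        ∫⁻ x, (u x : ℝ≥0∞) ∂μ.toMeasure ≤
          ∫⁻ x, (v x : ℝ≥0∞) ∂μ.toMeasure + δ * ∫⁻ x, (D j x : ℝ≥0∞) ∂μ.toMeasure := by
      intro δ u v huv μ
      rw [← lintegral_const_mul _ (measurable_coe_testFunction (D j)),
        ← lintegral_add_left (measurable_coe_testFunction v)]
      exact lintegral_mono fun x => by
        have := ENNReal.coe_le_coe.2 (huv x)
        rwa [ENNReal.coe_add, ENNReal.coe_mul] at this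
    have hj_top := (lintegral_lt_top μ₀ (D j)).ne
    refine (ENNReal.tendsto_nhds (lintegral_lt_top μ₀ f).ne).2 fun ε hε => ?_
    -- Replacing `f` by `D i` costs `δ ∫ D j` at `μ` and again at `μ₀`; near `μ₀` the former is at
    -- most `δ (∫ D j dμ₀ + 1)`. The other `ε / 2` pays for the variation of `∫ D i`.
    obtain ⟨δ, hδ, hδε⟩ : ∃ δ : ℝ≥0, 0 < δ ∧
        δ * (∫⁻ x, (D j x : ℝ≥0∞) ∂μ₀.toMeasure + 1 +
          ∫⁻ x, (D j x : ℝ≥0∞) ∂μ₀.toMeasure) ≤ ε / 2 := by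
      have h := ENNReal.exists_nnreal_pos_mul_lt
        (a := ∫⁻ x, (D j x : ℝ≥0∞) ∂μ₀.toMeasure + 1 + ∫⁻ x, (D j x : ℝ≥0∞) ∂μ₀.toMeasure)
        (b := ε / 2) (by finiteness) (ENNReal.half_pos hε.ne').ne'
      obtain ⟨δ, hδ, h⟩ := h
      exact ⟨δ, hδ, h.le⟩
    obtain ⟨i, hi⟩ := hj δ hδ
    have e1 := (ENNReal.tendsto_nhds (lintegral_lt_top μ₀ (D i)).ne).1 ((hc i).tendsto μ₀)
      (ε / 2) (ENNReal.half_pos hε.ne')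
    have e2 := (ENNReal.tendsto_nhds hj_top).1 ((hc j).tendsto μ₀) 1 one_pos
    filter_upwards [e1, e2] with μ h1 h2
    have a1 := hI δ f (D i) (fun x => (hi x).1)
    have a2 := hI δ (D i) f (fun x => (hi x).2)
    have b2 : (δ : ℝ≥0∞) * ∫⁻ x, (D j x : ℝ≥0∞) ∂μ.toMeasure ≤
        δ * (∫⁻ x, (D j x : ℝ≥0∞) ∂μ₀.toMeasure + 1) := by gcongr; exact h2.2
    rw [mul_add] at hδε
    constructor
    · rw [tsub_le_iff_right]
      calc _ ≤ _ := a1 μ₀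
        _ ≤ (∫⁻ x, (D i x : ℝ≥0∞) ∂μ.toMeasure + ε / 2) +
            δ * ∫⁻ x, (D j x : ℝ≥0∞) ∂μ₀.toMeasure := by
          gcongr
          exact tsub_le_iff_right.1 h1.1
        _ ≤ (∫⁻ x, (f x : ℝ≥0∞) ∂μ.toMeasure + δ * (∫⁻ x, (D j x : ℝ≥0∞) ∂μ₀.toMeasure + 1)
            + ε / 2) + δ * ∫⁻ x, (D j x : ℝ≥0∞) ∂μ₀.toMeasure := by
          gcongr
          exact (a2 μ).trans (by gcongr)
        _ = ∫⁻ x, (f x : ℝ≥0∞) ∂μ.toMeasure + (δ * (∫⁻ x, (D j x : ℝ≥0∞) ∂μ₀.toMeasure + 1)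
            + δ * ∫⁻ x, (D j x : ℝ≥0∞) ∂μ₀.toMeasure) + ε / 2 := by ring
        _ ≤ ∫⁻ x, (f x : ℝ≥0∞) ∂μ.toMeasure + ε / 2 + ε / 2 := by gcongr
        _ = _ := by rw [add_assoc, ENNReal.add_halves]
    · calc _ ≤ _ := a1 μ
        _ ≤ (∫⁻ x, (D i x : ℝ≥0∞) ∂μ₀.toMeasure + ε / 2) +
            δ * (∫⁻ x, (D j x : ℝ≥0∞) ∂μ₀.toMeasure + 1) := by
          gcongr
          exact h1.2
        _ ≤ (∫⁻ x, (f x : ℝ≥0∞) ∂μ₀.toMeasure + δ * ∫⁻ x, (D j x : ℝ≥0∞) ∂μ₀.toMeasure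
            + ε / 2) + δ * (∫⁻ x, (D j x : ℝ≥0∞) ∂μ₀.toMeasure + 1) := by
          gcongr
          exact a2 μ₀
        _ = ∫⁻ x, (f x : ℝ≥0∞) ∂μ₀.toMeasure + (δ * (∫⁻ x, (D j x : ℝ≥0∞) ∂μ₀.toMeasure + 1)
            + δ * ∫⁻ x, (D j x : ℝ≥0∞) ∂μ₀.toMeasure) + ε / 2 := by ring
        _ ≤ ∫⁻ x, (f x : ℝ≥0∞) ∂μ₀.toMeasure + ε / 2 + ε / 2 := by gcongr
        _ = _ := by rw [add_assoc, ENNReal.add_halves]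
  refine measurable_of_isOpen fun A hA => ?_
  obtain ⟨V, hV, rfl⟩ := isOpen_induced_iff.1 (hle A hA)
  exact hΦ hV.measurableSet

end Metric

end PointMeasure

/-! ### Uniqueness in law of a Poisson process. -/

section Finite

variable {S Ω Ω' : Type*} [TopologicalSpace S] [MeasurableSpace S] [MeasurableSpace Ω]
  [MeasurableSpace Ω'] {η : Ω → PointMeasure S} {η' : Ω' → PointMeasure S} {Λ : Measure S}
  {P : Measure Ω} {P' : Measure Ω'}

lemma IsPoissonProcess.map_count_eq [IsProbabilityMeasure P] [IsProbabilityMeasure P']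
    (h : IsPoissonProcess η Λ P) (h' : IsPoissonProcess η' Λ P')
    {B : Set S} (hB : MeasurableSet B) :
    P.map (fun ω => (η ω).toMeasure B) = P'.map (fun ω => (η' ω).toMeasure B) := by
  by_cases hΛ : Λ B = ∞
  · rw [Measure.map_congr (g := fun _ => ∞) (h.count_eq_top B hB hΛ),
      Measure.map_congr (g := fun _ => ∞) (h'.count_eq_top B hB hΛ)]
    simp
  · rw [(h.hasLaw_count B hB hΛ).map_eq, (h'.hasLaw_count B hB hΛ).map_eq]

lemma IsPoissonProcess.iIndepFun_count_fintype (h : IsPoissonProcess η Λ P) {κ : Type*}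
    [Fintype κ] {B : κ → Set S} (hB : ∀ k, MeasurableSet (B k))
    (hd : Pairwise fun k l => Disjoint (B k) (B l)) :
    iIndepFun (fun k ω => (η ω).toMeasure (B k)) P := by
  let e := Fintype.equivFin κ
  have := (h.iIndepFun_count _ (fun i => B (e.symm i)) (fun i => hB _)
    (fun i j hij => hd (e.symm.injective.ne hij))).precomp e.injective
  simpa using this

end Finite

/-- The atom `C σ` collects the points with membership pattern `σ`, and `L` sums the atoms contained
in each `B i`. This reduces joint counts of overlapping sets to disjoint ones, where independence
applies. -/
lemma exists_disjoint_atoms {S : Type*} [MeasurableSpace S] {ι : Type*} [Fintype ι]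
    {B : ι → Set S} (hB : ∀ i, MeasurableSet (B i)) :
    ∃ (C : (ι → Bool) → Set S) (L : ((ι → Bool) → ℝ≥0∞) → ι → ℝ≥0∞), (∀ σ, MeasurableSet (C σ)) ∧
      (Pairwise fun σ τ => Disjoint (C σ) (C τ)) ∧ Measurable L ∧
      ∀ μ : Measure S, (fun i => μ (B i)) = L fun σ => μ (C σ) := by
  classical
  let C : (ι → Bool) → Set S := fun σ => {x | ∀ i, x ∈ B i ↔ σ i = true}
  have hC : ∀ σ, MeasurableSet (C σ) := by
    intro σ
    have : C σ = ⋂ i, if σ i = true then B i else (B i)ᶜ := by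
      ext x
      simp only [C, Set.mem_ofPred_eq, Set.mem_iInter]
      refine forall_congr' fun i => ?_
      cases σ i <;> simp
    rw [this]
    refine MeasurableSet.iInter fun i => ?_
    split_ifs
    exacts [hB i, (hB i).compl]
  have hCd : Pairwise fun σ τ => Disjoint (C σ) (C τ) := by
    intro σ τ hστ
    refine Set.disjoint_left.2 fun x hx hx' => hστ (funext fun i => ?_)
    rw [Bool.eq_iff_iff, ← hx i, ← hx' i]
  have hBC : ∀ i, B i = ⋃ σ ∈ Finset.univ.filter (fun σ : ι → Bool => σ i = true), C σ := by
    intro i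
    ext x
    simp only [Finset.mem_filter, Finset.mem_univ, true_and, Set.mem_iUnion, exists_prop]
    constructor
    · intro hx
      exact ⟨fun j => decide (x ∈ B j), by simpa using hx, fun j => by simp⟩
    · rintro ⟨σ, hσ, hx⟩
      exact (hx i).2 hσ
  let L : ((ι → Bool) → ℝ≥0∞) → ι → ℝ≥0∞ := fun x i =>
    ∑ σ ∈ Finset.univ.filter (fun σ : ι → Bool => σ i = true), x σ
  have hL : Measurable L := by fun_prop
  refine ⟨C, L, hC, hCd, hL, fun μ => funext fun i => ?_⟩
  rw [hBC i, measure_biUnion_finset (fun σ _ τ _ hστ => hCd hστ) fun σ _ => hC σ]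

section Unique

variable {S Ω Ω' : Type*} [MetricSpace S] [ProperSpace S] [MeasurableSpace S] [BorelSpace S]
  [MeasurableSpace Ω] [MeasurableSpace Ω'] {η : Ω → PointMeasure S} {η' : Ω' → PointMeasure S}
  {Λ : Measure S} {P : Measure Ω} {P' : Measure Ω'}

lemma IsPoissonProcess.measurable_count (h : IsPoissonProcess η Λ P) {B : Set S}
    (hB : MeasurableSet B) : Measurable fun ω => (η ω).toMeasure B :=
  (PointMeasure.measurable_count hB).comp h.measurable

lemma IsPoissonProcess.map_counts_eq_map_pi (h : IsPoissonProcess η Λ P)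
    {ι κ : Type*} [Fintype κ] {B : ι → Set S} {C : κ → Set S} {L : (κ → ℝ≥0∞) → ι → ℝ≥0∞}
    (hC : ∀ k, MeasurableSet (C k)) (hCd : Pairwise fun k l => Disjoint (C k) (C l))
    (hL : Measurable L) (hsum : ∀ μ : Measure S, (fun i => μ (B i)) = L fun k => μ (C k)) :
    P.map (fun ω i => (η ω).toMeasure (B i)) =
      (Measure.pi fun k => P.map fun ω => (η ω).toMeasure (C k)).map L := by
  have hm : ∀ k, Measurable fun ω => (η ω).toMeasure (C k) := fun k => h.measurable_count (hC k)
  rw [← (h.iIndepFun_count_fintype hC hCd).map_fun_eq_pi_map fun k => (hm k).aemeasurable,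
    Measure.map_map hL (measurable_pi_lambda _ hm)]
  congr 1
  funext ω
  exact hsum _

lemma IsPoissonProcess.map_counts_eq [IsProbabilityMeasure P] [IsProbabilityMeasure P']
    (h : IsPoissonProcess η Λ P) (h' : IsPoissonProcess η' Λ P')
    {ι : Type*} [Fintype ι] {B : ι → Set S} (hB : ∀ i, MeasurableSet (B i)) :
    P.map (fun ω i => (η ω).toMeasure (B i)) = P'.map (fun ω i => (η' ω).toMeasure (B i)) := by
  classical
  obtain ⟨C, L, hC, hCd, hL, hsum⟩ := exists_disjoint_atoms hB
  rw [h.map_counts_eq_map_pi hC hCd hL hsum, h'.map_counts_eq_map_pi hC hCd hL hsum]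
  congr 2
  funext σ
  exact h.map_count_eq h' (hC σ)

/-- The law of a Poisson process is determined by its intensity measure. -/
theorem IsPoissonProcess.map_eq [IsProbabilityMeasure P] [IsProbabilityMeasure P']
    (h : IsPoissonProcess η Λ P) (h' : IsPoissonProcess η' Λ P') :
    P.map η = P'.map η' := by
  let Φ : PointMeasure S → {B : Set S // MeasurableSet B} → ℝ≥0∞ := fun μ B => μ.toMeasure B
  have hΦ : Measurable Φ := measurable_pi_lambda _ fun B => PointMeasure.measurable_count B.2
  -- A finite measure on a product is determined by its finite-dimensional marginals.
  have hlaw : P.map (Φ ∘ η) = P'.map (Φ ∘ η') := by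
    have : IsFiniteMeasure (P'.map (Φ ∘ η')) := by infer_instance
    refine IsProjectiveLimit.unique (P := fun J => (P'.map (Φ ∘ η')).map J.restrict)
      (fun J => ?_) (fun J => rfl)
    have e := h.map_counts_eq h' (B := fun B : J => (B : {B : Set S // MeasurableSet B}).1)
      (fun B => B.1.2)
    beta_reduce
    rw [Measure.map_map (Finset.measurable_restrict J) (hΦ.comp h.measurable),
      Measure.map_map (Finset.measurable_restrict J) (hΦ.comp h'.measurable)]
    exact e
  refine Measure.ext fun A hA => ?_
  -- Applying `measurable_of_count` to the identity, with the σ-algebra generated by the counts on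
  -- the source, shows that every vague Borel set is a `Φ`-preimage.
  have hid : @Measurable _ _ (MeasurableSpace.comap Φ inferInstance) _
      (id : PointMeasure S → PointMeasure S) :=
    @PointMeasure.measurable_of_count S _ _ _ _ _ (MeasurableSpace.comap Φ inferInstance) _
      fun B hB => (measurable_pi_apply (⟨B, hB⟩ : {B : Set S // MeasurableSet B})).comp
        (comap_measurable Φ)
  obtain ⟨V, hV, hVA⟩ := hid hA
  rw [Set.preimage_id] at hVA
  rw [← hVA, ← Measure.map_apply hΦ hV, ← Measure.map_apply hΦ hV,
    Measure.map_map hΦ h.measurable, Measure.map_map hΦ h'.measurable, hlaw]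

end Unique

/-! ### Mixed binomial processes: a Poisson number of i.i.d. points. -/

section Binomial

variable {S : Type*} [MeasurableSpace S]

/-- A Poisson number of points together with an i.i.d. sequence of positions. -/
noncomputable def mixedBinomial (r : ℝ≥0) (ν : Measure S) [IsProbabilityMeasure ν] :
    Measure (ℕ × (ℕ → S)) :=
  (poissonMeasure r).prod (Measure.infinitePi fun _ => ν)

instance (r : ℝ≥0) (ν : Measure S) [IsProbabilityMeasure ν] :
    IsProbabilityMeasure (mixedBinomial r ν) := by
  unfold mixedBinomial; infer_instance

open Classical in
/-- The number of the first `p.1` points of the sequence `p.2` that lie in `B`. -/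
noncomputable def pointCount (B : Set S) (p : ℕ × (ℕ → S)) : ℕ :=
  ∑ j ∈ Finset.range p.1, if p.2 j ∈ B then 1 else 0

lemma measurable_pointCount {B : Set S} (hB : MeasurableSet B) : Measurable (pointCount B) := by
  classical
  refine measurable_from_prod_countable_right fun k => ?_
  change Measurable fun x : ℕ → S => ∑ j ∈ Finset.range k, if x j ∈ B then (1 : ℕ) else 0
  refine Finset.measurable_fun_sum _ fun j _ => ?_
  exact Measurable.ite (measurable_pi_apply j hB) measurable_const measurable_const

lemma integral_infinitePi_prod_pow (ν : Measure S) [IsProbabilityMeasure ν] {g : S → ℂ}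
    (hg : Measurable g) (k : ℕ) :
    ∫ x : ℕ → S, ∏ j ∈ Finset.range k, g (x j) ∂(Measure.infinitePi fun _ => ν) =
      (∫ s, g s ∂ν) ^ k := by
  have hind : iIndepFun (fun (j : Fin k) (x : ℕ → S) => g (x j))
      (Measure.infinitePi fun _ : ℕ => ν) :=
    (iIndepFun_infinitePi (P := fun _ : ℕ => ν) (X := fun _ => g) fun _ => hg).precomp
      Fin.val_injective
  simp_rw [Finset.prod_range]
  rw [hind.integral_fun_prod_eq_prod_integral fun j =>
    (hg.comp (measurable_pi_apply _)).aestronglyMeasurable]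
  have : ∀ j : ℕ, ∫ x : ℕ → S, g (x j) ∂(Measure.infinitePi fun _ => ν) = ∫ s, g s ∂ν := by
    intro j
    conv_rhs => rw [← Measure.infinitePi_map_eval (fun _ : ℕ => ν) j]
    rw [integral_map (measurable_pi_apply j).aemeasurable hg.aestronglyMeasurable]
  simp [this]

lemma integral_poissonMeasure_pow (r : ℝ≥0) (z : ℂ) :
    ∫ k, z ^ k ∂(poissonMeasure r) = Complex.exp (r * (z - 1)) := by
  rw [integral_poissonMeasure]
  calc ∑' a : ℕ, (Real.exp (-r) * r ^ a / a.factorial : ℝ) • z ^ a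
  _ = ∑' a : ℕ, (Real.exp (-r) : ℂ) * ((r * z) ^ a / a.factorial) := by
      congr with a
      rw [Complex.real_smul, mul_pow]
      push_cast
      ring
  _ = Real.exp (-r) * ∑' a : ℕ, ((r * z) ^ a / a.factorial) := tsum_mul_left
  _ = Real.exp (-r) * Complex.exp (r * z) := by
      rw [(NormedSpace.expSeries_div_hasSum_exp (r * z)).tsum_eq, Complex.exp_eq_exp_ℂ]
  _ = Complex.exp (r * (z - 1)) := by
      rw [Complex.ofReal_exp, ← Complex.exp_add]
      push_cast
      ring_nf

/-- Given `k` points, the i.i.d. positions contribute the `k`-th power of `∫ g dν`; the Poisson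
generating function then averages over `k`. -/
lemma integral_mixedBinomial_prod (r : ℝ≥0) (ν : Measure S) [IsProbabilityMeasure ν] {g : S → ℂ}
    (hg : Measurable g) (hg1 : ∀ s, ‖g s‖ ≤ 1) :
    ∫ p, ∏ j ∈ Finset.range p.1, g (p.2 j) ∂(mixedBinomial r ν) =
      Complex.exp (r * (∫ s, g s ∂ν - 1)) := by
  have hm : Measurable fun p : ℕ × (ℕ → S) => ∏ j ∈ Finset.range p.1, g (p.2 j) :=
    measurable_from_prod_countable_right fun k =>
      Finset.measurable_fun_prod (Finset.range k) (f := fun j (x : ℕ → S) => g (x j))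
        fun j _ => hg.comp (measurable_pi_apply j)
  have hint : Integrable (fun p : ℕ × (ℕ → S) => ∏ j ∈ Finset.range p.1, g (p.2 j))
      (mixedBinomial r ν) :=
    .of_bound hm.aestronglyMeasurable 1 (.of_forall fun p => by
      rw [norm_prod]
      exact Finset.prod_le_one (fun _ _ => norm_nonneg _) fun _ _ => hg1 _)
  unfold mixedBinomial at hint ⊢
  rw [integral_prod _ hint]
  simp_rw [integral_infinitePi_prod_pow ν hg]
  exact integral_poissonMeasure_pow r _

/-- By disjointness, `exp (i ∑ t_i 1_{B_i}) = 1 + ∑ 1_{B_i} (exp (i t_i) - 1)`, so the exponent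
splits as a sum over the sets. The factorized characteristic function yields both the Poisson laws
and the independence of the counts. -/
lemma integral_exp_sum_pointCount (r : ℝ≥0) (ν : Measure S) [IsProbabilityMeasure ν] {ι : Type*}
    [Fintype ι] {B : ι → Set S} (hB : ∀ i, MeasurableSet (B i))
    (hd : Pairwise fun i j => Disjoint (B i) (B j)) (t : ι → ℝ) :
    ∫ p, Complex.exp ((∑ i, (pointCount (B i) p : ℝ) * t i : ℝ) * Complex.I)
      ∂(mixedBinomial r ν) =
      ∏ i, Complex.exp (r * ν.real (B i) * (Complex.exp (t i * Complex.I) - 1)) := by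
  classical
  let g : S → ℂ := fun s => Complex.exp ((∑ i, (if s ∈ B i then t i else 0) : ℝ) * Complex.I)
  have hg : Measurable g := by
    refine Complex.measurable_exp.comp (Measurable.mul_const (Complex.measurable_ofReal.comp
      (Finset.measurable_fun_sum _ fun i _ => ?_)) _)
    exact Measurable.ite (hB i) measurable_const measurable_const
  have hg1 : ∀ s, ‖g s‖ ≤ 1 := fun s => (Complex.norm_exp_ofReal_mul_I _).le
  have hprod : ∀ p : ℕ × (ℕ → S),
      Complex.exp ((∑ i, (pointCount (B i) p : ℝ) * t i : ℝ) * Complex.I) =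
        ∏ j ∈ Finset.range p.1, g (p.2 j) := by
    intro p
    rw [← Complex.exp_sum, ← Finset.sum_mul, ← Complex.ofReal_sum, Finset.sum_comm]
    congr 3
    refine Finset.sum_congr rfl fun i _ => ?_
    simp [pointCount, Finset.sum_ite]
  have hgs : ∀ s, g s = 1 + ∑ i, (B i).indicator (fun _ => Complex.exp (t i * Complex.I) - 1) s := by
    intro s
    by_cases hs : ∃ i, s ∈ B i
    · obtain ⟨i, hi⟩ := hs
      have hne : ∀ j, j ≠ i → s ∉ B j := fun j hj h => Set.disjoint_left.1 (hd hj) h hi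
      simp only [g]
      rw [Finset.sum_eq_single i (fun j _ hj => by simp [hne j hj]) (by simp),
        Finset.sum_eq_single i (fun j _ hj => by simp [hne j hj]) (by simp)]
      simp [hi]
    · push Not at hs
      simp [g, hs]
  simp_rw [hprod]
  rw [integral_mixedBinomial_prod r ν hg hg1, ← Complex.exp_sum]
  congr 1
  have hi : ∀ i, Integrable ((B i).indicator fun _ => Complex.exp (t i * Complex.I) - 1) ν :=
    fun i => (integrable_const _).indicator (hB i)
  simp_rw [hgs]
  rw [integral_add (integrable_const _) (integrable_finsetSum _ fun i _ => hi i),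
    integral_finsetSum _ fun i _ => hi i]
  simp only [integral_const, probReal_univ, one_smul, integral_indicator_const _ (hB _),
    add_sub_cancel_left, Finset.mul_sum, Complex.real_smul]
  exact Finset.sum_congr rfl fun i _ => by ring

lemma map_pointCount (r : ℝ≥0) (ν : Measure S) [IsProbabilityMeasure ν] {B : Set S}
    (hB : MeasurableSet B) :
    (mixedBinomial r ν).map (pointCount B) = poissonMeasure (r * (ν B).toNNReal) := by
  have hm := measurable_pointCount hB
  apply (MeasurableEmbedding.natCast (α := ℝ)).map_injective
  apply Measure.ext_of_charFun
  ext t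
  rw [charFun_map_cast_poissonMeasure, Measure.map_map (by fun_prop) hm, charFun_apply_real,
    integral_map (Measurable.aemeasurable (by fun_prop)) (by fun_prop)]
  have h := integral_exp_sum_pointCount r ν (ι := Unit) (B := fun _ => B) (fun _ => hB)
    (fun i j hij => (hij rfl).elim) fun _ => t
  simp only [Finset.univ_unique, Finset.sum_singleton, Finset.prod_singleton] at h
  rw [show ((r * (ν B).toNNReal : ℝ≥0) : ℂ) = r * ν.real B by
    simp [Measure.real, ENNReal.toReal], ← h]
  refine integral_congr_ae (.of_forall fun p => ?_)
  simp only [Function.comp_apply]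
  push_cast
  ring_nf

lemma iIndepFun_pointCount (r : ℝ≥0) (ν : Measure S) [IsProbabilityMeasure ν] {ι : Type*}
    [Fintype ι] {B : ι → Set S} (hB : ∀ i, MeasurableSet (B i))
    (hd : Pairwise fun i j => Disjoint (B i) (B j)) :
    iIndepFun (fun i => pointCount (B i)) (mixedBinomial r ν) := by
  have hm := fun i => measurable_pointCount (hB i)
  have hR : iIndepFun (fun i p => (pointCount (B i) p : ℝ)) (mixedBinomial r ν) := by
    rw [iIndepFun_iff_charFun_pi fun i => Measurable.aemeasurable (by fun_prop)]
    intro t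
    rw [charFun_apply, integral_map (Measurable.aemeasurable (by fun_prop)) (by fun_prop)]
    have h1 : ∀ i, charFun ((mixedBinomial r ν).map fun p => (pointCount (B i) p : ℝ)) (t i) =
        Complex.exp (r * ν.real (B i) * (Complex.exp (t i * Complex.I) - 1)) := by
      intro i
      have := map_pointCount r ν (hB i)
      rw [show (fun p => (pointCount (B i) p : ℝ)) = (fun n : ℕ => (n : ℝ)) ∘ pointCount (B i)
        from rfl, ← Measure.map_map (by fun_prop) (hm i), this, charFun_map_cast_poissonMeasure,
        show ((r * (ν (B i)).toNNReal : ℝ≥0) : ℂ) = r * ν.real (B i) by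
          simp [Measure.real, ENNReal.toReal]]
    simp_rw [h1]
    rw [← integral_exp_sum_pointCount r ν hB hd]
    refine integral_congr_ae (.of_forall fun p => ?_)
    simp [PiLp.inner_apply, mul_comm]
  -- The floor undoes the cast to `ℝ`, which was needed only for characteristic functions.
  have := hR.comp (fun _ x => ⌊x⌋₊) fun _ => Nat.measurable_floor
  simpa [Function.comp_def] using this

end Binomial

/-! ### Regrouping independent families, and series of independent Poisson variables. -/

section Independence

variable {Ω Ω' : Type*} [MeasurableSpace Ω] [MeasurableSpace Ω'] {P : Measure Ω}
  [IsProbabilityMeasure P]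

lemma iIndepFun_map_iff {ι : Type*} {𝓧 : ι → Type*} [∀ i, MeasurableSpace (𝓧 i)] {g : Ω → Ω'}
    (hg : Measurable g) {f : ∀ i, Ω' → 𝓧 i} (hf : ∀ i, Measurable (f i)) :
    iIndepFun f (P.map g) ↔ iIndepFun (fun i ω => f i (g ω)) P := by
  have := Measure.isProbabilityMeasure_map (μ := P) hg.aemeasurable
  rw [iIndepFun_iff_map_fun_eq_infinitePi_map hf,
    iIndepFun_iff_map_fun_eq_infinitePi_map (X := fun i ω => f i (g ω))
      fun i => (hf i).comp hg,
    Measure.map_map (measurable_pi_lambda _ hf) hg]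
  simp_rw [Measure.map_map (hf _) hg]
  rfl

lemma iIndepFun_curry {ι : Type*} {κ : ι → Type*} {𝓧 : (i : ι) → κ i → Type*}
    [∀ i j, MeasurableSpace (𝓧 i j)] {X : (i : ι) → (j : κ i) → Ω → 𝓧 i j}
    (mX : ∀ i j, Measurable (X i j))
    (h : iIndepFun (fun (p : (i : ι) × κ i) ω => X p.1 p.2 ω) P) :
    iIndepFun (fun i ω => (X i · ω)) P := by
  have hp : ∀ i j, IsProbabilityMeasure (P.map (X i j)) :=
    fun i j => Measure.isProbabilityMeasure_map (mX i j).aemeasurable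
  have hcomp : (MeasurableEquiv.piCurry 𝓧) ∘ (fun ω p => X p.1 p.2 ω) = fun ω i j => X i j ω := by
    ext; simp [Sigma.curry]
  have hrow : ∀ i, P.map (fun ω => (X i · ω)) = Measure.infinitePi fun j => P.map (X i j) :=
    fun i => (iIndepFun_iff_map_fun_eq_infinitePi_map (mX i)).1
      (h.precomp (g := fun j : κ i => (⟨i, j⟩ : (i : ι) × κ i)) sigma_mk_injective)
  rw [iIndepFun_iff_map_fun_eq_infinitePi_map (fun i => measurable_pi_lambda _ (mX i)), ← hcomp,
    ← Measure.map_map (by fun_prop) (measurable_pi_lambda _ fun p => mX p.1 p.2),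
    (iIndepFun_iff_map_fun_eq_infinitePi_map fun p => mX p.1 p.2).1 h,
    Measure.infinitePi_map_piCurry fun i j => P.map (X i j)]
  simp_rw [hrow]

end Independence

section PoissonSum

lemma poissonMeasure_apply (r : ℝ≥0) (s : Finset ℕ) :
    poissonMeasure r s =
      ∑ n ∈ s, ENNReal.ofReal (Real.exp (-r) * (r : ℝ) ^ n / n.factorial) := by
  rw [← sum_measure_singleton]
  simp_rw [poissonMeasure_singleton]

lemma tendsto_poissonMeasure_finset {ι : Type*} {l : Filter ι} {r : ι → ℝ≥0} {a : ℝ≥0}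
    (h : Tendsto r l (𝓝 a)) (s : Finset ℕ) :
    Tendsto (fun i => poissonMeasure (r i) s) l (𝓝 (poissonMeasure a s)) := by
  simp_rw [poissonMeasure_apply]
  refine tendsto_finsetSum _ fun n _ => ENNReal.tendsto_ofReal ?_
  have hc : Continuous fun x : ℝ≥0 => Real.exp (-x) * (x : ℝ) ^ n / n.factorial := by fun_prop
  exact (hc.tendsto a).comp h

lemma tendsto_poissonMeasure_finset_zero {ι : Type*} {l : Filter ι} {r : ι → ℝ≥0}
    (h : Tendsto r l atTop) (s : Finset ℕ) :
    Tendsto (fun i => poissonMeasure (r i) s) l (𝓝 0) := by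
  simp_rw [poissonMeasure_apply]
  rw [← Finset.sum_const_zero (s := s) (M := ℝ≥0∞)]
  refine tendsto_finsetSum _ fun n _ => ?_
  rw [← ENNReal.ofReal_zero]
  refine ENNReal.tendsto_ofReal ?_
  have h1 := (Real.tendsto_pow_mul_exp_neg_atTop_nhds_zero n).div_const (n.factorial : ℝ)
  rw [zero_div] at h1
  refine (h1.comp (NNReal.tendsto_coe_atTop.2 h)).congr fun i => ?_
  simp [mul_comm]

variable {Ω : Type*} [MeasurableSpace Ω] {P : Measure Ω} [IsProbabilityMeasure P] {X : ℕ → Ω → ℕ}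
  {r : ℕ → ℝ≥0}

lemma ProbabilityTheory.iIndepFun.hasLaw_sum_range_poissonMeasure (hX : iIndepFun X P)
    (hm : ∀ n, Measurable (X n))
    (hlaw : ∀ n, P.map (X n) = poissonMeasure (r n)) (m : ℕ) :
    HasLaw (∑ n ∈ Finset.range m, X n) (poissonMeasure (∑ n ∈ Finset.range m, r n)) P := by
  induction m with
  | zero =>
    refine ⟨by fun_prop, ?_⟩
    refine Measure.ext_of_singleton fun n => ?_
    rw [Finset.sum_range_zero, Finset.sum_range_zero, Pi.zero_def, Measure.map_const,
      poissonMeasure_singleton]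
    rcases Nat.eq_zero_or_pos n with rfl | hn
    · simp
    · simp [hn.ne', hn.ne]
  | succ m ih =>
    rw [Finset.sum_range_succ, Finset.sum_range_succ]
    exact (hX.indepFun_finsetSum_of_notMem hm Finset.notMem_range_self).hasLaw_add_poissonMeasure
      ih ⟨(hm m).aemeasurable, hlaw m⟩

/-- Makes the events `{≤ a}` finite sums of Poisson point masses, whose limits in the parameter are
explicit. -/
lemma exists_finset_preimage_Iic {a : ℝ≥0∞} (ha : a ≠ ∞) :
    ∃ s : Finset ℕ, (fun n : ℕ => (n : ℝ≥0∞)) ⁻¹' Set.Iic a = s := by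
  refine ⟨Finset.range (⌊a.toNNReal⌋₊ + 1), ?_⟩
  ext n
  lift a to ℝ≥0 using ha
  simp only [Set.mem_preimage, Set.mem_Iic, ENNReal.toNNReal_coe, Finset.coe_range, Set.mem_Iio,
    Order.lt_add_one_iff]
  rw [Nat.le_floor_iff zero_le]
  exact_mod_cast Iff.rfl

/-- The partial sums increase to the series, so the events decrease to their intersection:
continuity from above. -/
lemma tendsto_measure_sum_le (hX : ∀ n, Measurable (X n)) (a : ℝ≥0∞) :
    Tendsto (fun m => P {ω | ((∑ n ∈ Finset.range m, X n ω : ℕ) : ℝ≥0∞) ≤ a}) atTop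
      (𝓝 (P {ω | ∑' n, (X n ω : ℝ≥0∞) ≤ a})) := by
  have hm : ∀ m, Measurable fun ω => ((∑ n ∈ Finset.range m, X n ω : ℕ) : ℝ≥0∞) := fun m =>
    (measurable_of_countable fun n : ℕ => (n : ℝ≥0∞)).comp
      (Finset.measurable_fun_sum _ fun n _ => hX n)
  have hmono : ∀ ω, Monotone fun m => ((∑ n ∈ Finset.range m, X n ω : ℕ) : ℝ≥0∞) :=
    fun ω m m' hmm' => by
      beta_reduce
      exact_mod_cast Finset.sum_le_sum_of_subset (Finset.range_mono hmm')
  have hset : {ω | ∑' n, (X n ω : ℝ≥0∞) ≤ a} =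
      ⋂ m, {ω | ((∑ n ∈ Finset.range m, X n ω : ℕ) : ℝ≥0∞) ≤ a} := by
    ext ω
    simp [ENNReal.tsum_eq_iSup_nat]
  rw [hset]
  exact tendsto_measure_iInter_atTop
    (fun m => (measurableSet_le (hm m) measurable_const).nullMeasurableSet)
    (fun m m' hmm' ω hω => (hmono ω hmm').trans hω) ⟨0, measure_ne_top _ _⟩

lemma ProbabilityTheory.iIndepFun.measure_sum_le_poissonMeasure (hX : iIndepFun X P)
    (hm : ∀ n, Measurable (X n))
    (hlaw : ∀ n, P.map (X n) = poissonMeasure (r n)) (m : ℕ) (a : ℝ≥0∞) :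
    P {ω | ((∑ n ∈ Finset.range m, X n ω : ℕ) : ℝ≥0∞) ≤ a} =
      poissonMeasure (∑ n ∈ Finset.range m, r n) ((fun n : ℕ => (n : ℝ≥0∞)) ⁻¹' Set.Iic a) := by
  have h := hX.hasLaw_sum_range_poissonMeasure hm hlaw m
  rw [← h.map_eq, Measure.map_apply_of_aemeasurable h.aemeasurable .of_discrete]
  congr 1
  ext ω
  simp

/-- A convergent series of independent Poisson variables is Poisson. -/
lemma ProbabilityTheory.iIndepFun.map_tsum_poissonMeasure (hX : iIndepFun X P)
    (hm : ∀ n, Measurable (X n))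
    (hlaw : ∀ n, P.map (X n) = poissonMeasure (r n)) {a : ℝ≥0} (hr : HasSum r a) :
    P.map (fun ω => ∑' n, (X n ω : ℝ≥0∞)) =
      (poissonMeasure a).map (fun n : ℕ => (n : ℝ≥0∞)) := by
  have hms : Measurable fun ω => ∑' n, (X n ω : ℝ≥0∞) := Measurable.tsum fun n =>
    (measurable_of_countable fun n : ℕ => (n : ℝ≥0∞)).comp (hm n)
  have := Measure.isProbabilityMeasure_map (μ := P) hms.aemeasurable
  refine Measure.ext_of_Iic _ _ fun b => ?_
  rw [Measure.map_apply hms measurableSet_Iic,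
    Measure.map_apply (measurable_of_countable _) measurableSet_Iic]
  by_cases hb : b = ∞
  · simp [hb]
  obtain ⟨s, hs⟩ := exists_finset_preimage_Iic hb
  have h1 := tendsto_measure_sum_le (P := P) hm b
  simp_rw [hX.measure_sum_le_poissonMeasure hm hlaw, hs] at h1
  rw [hs]
  exact tendsto_nhds_unique h1 (tendsto_poissonMeasure_finset hr.tendsto_sum_nat s)

/-- A divergent series of independent Poisson variables is almost surely infinite. -/
lemma ProbabilityTheory.iIndepFun.tsum_eq_top_of_poissonMeasure (hX : iIndepFun X P)
    (hm : ∀ n, Measurable (X n))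
    (hlaw : ∀ n, P.map (X n) = poissonMeasure (r n))
    (hr : Tendsto (fun m => ∑ n ∈ Finset.range m, r n) atTop atTop) :
    ∀ᵐ ω ∂P, ∑' n, (X n ω : ℝ≥0∞) = ∞ := by
  have h0 : ∀ k : ℕ, P {ω | ∑' n, (X n ω : ℝ≥0∞) ≤ k} = 0 := by
    intro k
    obtain ⟨s, hs⟩ := exists_finset_preimage_Iic (ENNReal.natCast_ne_top k)
    have h1 := tendsto_measure_sum_le (P := P) hm k
    simp_rw [hX.measure_sum_le_poissonMeasure hm hlaw, hs] at h1
    exact tendsto_nhds_unique h1 (tendsto_poissonMeasure_finset_zero hr s)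
  rw [ae_iff]
  refine measure_mono_null (fun ω hω => ?_) (measure_iUnion_null h0)
  obtain ⟨k, hk⟩ := ENNReal.exists_nat_gt hω
  exact Set.mem_iUnion.2 ⟨k, hk.le⟩

end PoissonSum

/-! ### Existence of Poisson processes by superposition over annuli. -/

section Superposition

lemma exists_eq_smul_isProbabilityMeasure {S : Type*} [MeasurableSpace S] [Nonempty S]
    (M : Measure S) [IsFiniteMeasure M] :
    ∃ (r : ℝ≥0) (ν : Measure S), IsProbabilityMeasure ν ∧
      ∀ B, r * (ν B).toNNReal = (M B).toNNReal := by
  by_cases hM : M = 0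
  · exact ⟨0, Measure.dirac (Classical.arbitrary S), inferInstance, fun B => by simp [hM]⟩
  · have : NeZero M := ⟨hM⟩
    refine ⟨(M Set.univ).toNNReal, (M Set.univ)⁻¹ • M, isProbabilityMeasureSMul, fun B => ?_⟩
    rw [← ENNReal.toNNReal_mul, Measure.smul_apply, smul_eq_mul, ← mul_assoc,
      ENNReal.mul_inv_cancel (by simpa using hM) (measure_ne_top _ _), one_mul]

/-- The series counts the disjoint union of the finite sets `Fin (c n)`. -/
lemma exists_enat_eq_tsum_natCast (c : ℕ → ℕ) :
    ∃ m : ℕ∞, ∑' n, (c n : ℝ≥0∞) = (m : ℝ≥0∞) := by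
  refine ⟨ENat.card (Σ n, Fin (c n)), ?_⟩
  rw [← mul_one ((ENat.card _ : ℕ∞) : ℝ≥0∞), ← ENNReal.tsum_const, ENNReal.tsum_sigma']
  simp

variable {S : Type*} [MeasurableSpace S]

/-- The superposition of the first `(ω n).1` points of the sequences `(ω n).2`, the `n`-th of them
restricted to `A n`. -/
noncomputable def superposition (A : ℕ → Set S) (ω : ℕ → ℕ × (ℕ → S)) : Measure S :=
  Measure.sum fun n => (∑ j ∈ Finset.range (ω n).1, Measure.dirac ((ω n).2 j)).restrict (A n)

lemma superposition_apply {A : ℕ → Set S} (hA : ∀ n, MeasurableSet (A n))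
    (ω : ℕ → ℕ × (ℕ → S)) {B : Set S} (hB : MeasurableSet B) :
    superposition A ω B = ∑' n, (pointCount (B ∩ A n) (ω n) : ℝ≥0∞) := by
  classical
  rw [superposition, Measure.sum_apply _ hB]
  congr 1
  funext n
  rw [Measure.restrict_apply hB, Measure.finsetSum_apply]
  simp_rw [Measure.dirac_apply' _ (hB.inter (hA n))]
  rw [pointCount, Nat.cast_sum]
  refine Finset.sum_congr rfl fun j _ => ?_
  by_cases h : (ω n).2 j ∈ B ∩ A n
  · rw [Set.indicator_of_mem h, if_pos h]; simp
  · rw [Set.indicator_of_notMem h, if_neg h]; simp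

/-- The annuli `n ≤ dist x x₀ < n + 1`. -/
def annulus [Dist S] (x₀ : S) (n : ℕ) : Set S := {x | ⌊dist x x₀⌋₊ = n}

end Superposition

section Annulus

variable {S : Type*} [MetricSpace S] (x₀ : S)

lemma pairwise_disjoint_annulus : Pairwise fun m n => Disjoint (annulus x₀ m) (annulus x₀ n) :=
  fun _ _ hmn => Set.disjoint_left.2 fun _ hx hx' => hmn (hx.symm.trans hx')

lemma iUnion_annulus : ⋃ n, annulus x₀ n = Set.univ :=
  Set.eq_univ_of_forall fun _ => Set.mem_iUnion.2 ⟨_, rfl⟩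

lemma annulus_subset_ball (n : ℕ) : annulus x₀ n ⊆ Metric.ball x₀ (n + 1) := by
  rintro x rfl
  exact Nat.lt_floor_add_one (dist x x₀)

lemma ball_inter_annulus {R n : ℕ} (h : R ≤ n) : Metric.ball x₀ R ∩ annulus x₀ n = ∅ := by
  refine Set.eq_empty_of_forall_notMem ?_
  rintro x ⟨hx, rfl⟩
  have h1 := Nat.floor_le (dist_nonneg (x := x) (y := x₀))
  have h2 : (R : ℝ) ≤ ⌊dist x x₀⌋₊ := by exact_mod_cast h
  exact absurd (Metric.mem_ball.1 hx) (not_lt.2 (h2.trans h1))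

variable [MeasurableSpace S] [BorelSpace S]

lemma measurableSet_annulus (n : ℕ) : MeasurableSet (annulus x₀ n) :=
  (Nat.measurable_floor.comp (continuous_id.dist continuous_const).measurable)
    (measurableSet_singleton n)

lemma tsum_measure_inter_annulus (Λ : Measure S) {B : Set S} (hB : MeasurableSet B) :
    ∑' n, Λ (B ∩ annulus x₀ n) = Λ B := by
  rw [← measure_iUnion (fun m n hmn => ((pairwise_disjoint_annulus x₀ hmn).mono
    Set.inter_subset_right Set.inter_subset_right)) fun n => hB.inter (measurableSet_annulus x₀ n),
    ← Set.inter_iUnion, iUnion_annulus, Set.inter_univ]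

/-- The superposition of finite point patterns in the annuli, as a point measure. -/
noncomputable def superpositionPointMeasure (ω : ℕ → ℕ × (ℕ → S)) : PointMeasure S where
  toMeasure := superposition (annulus x₀) ω
  locallyFinite := by
    refine ⟨fun x => ?_⟩
    obtain ⟨R, hR⟩ := exists_nat_gt (dist x x₀)
    refine ⟨Metric.ball x₀ R, Metric.isOpen_ball.mem_nhds hR, ?_⟩
    rw [superposition_apply (measurableSet_annulus x₀) ω Metric.isOpen_ball.measurableSet,
      -- A ball of radius `R` meets only the first `R` annuli, each carrying finitely many points.
      tsum_eq_sum (s := Finset.range R) fun n hn => by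
        rw [ball_inter_annulus x₀ (by simpa using hn)]
        simp [pointCount]]
    exact ENNReal.sum_lt_top.2 fun n _ => ENNReal.natCast_lt_top _
  integerValued := fun B hB => by
    rw [superposition_apply (measurableSet_annulus x₀) ω hB]
    exact exists_enat_eq_tsum_natCast _

end Annulus

section Existence

variable {S : Type*} [MetricSpace S] [ProperSpace S] [MeasurableSpace S] [BorelSpace S]

/-- Bounded sets are relatively compact here, so `Λ` is finite on each annulus and normalizes to a
position law there. The count of `B` is a series of independent Poisson variables with parameters
summing to `Λ B`; it is Poisson or almost surely infinite according to whether this sum converges.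
-/
theorem exists_isPoissonProcess [Nonempty S] (Λ : Measure S) [IsLocallyFiniteMeasure Λ] :
    ∃ (P : Measure (ℕ → ℕ × (ℕ → S))) (η : (ℕ → ℕ × (ℕ → S)) → PointMeasure S),
      IsProbabilityMeasure P ∧ IsPoissonProcess η Λ P := by
  obtain ⟨x₀⟩ := ‹Nonempty S›
  have hfin : ∀ n, Λ (annulus x₀ n) < ∞ := fun n =>
    (Metric.isBounded_ball.subset (annulus_subset_ball x₀ n)).measure_lt_top
  have hex : ∀ n, ∃ (r : ℝ≥0) (ν : Measure S), IsProbabilityMeasure ν ∧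
      ∀ B, r * (ν B).toNNReal = ((Λ.restrict (annulus x₀ n)) B).toNNReal := fun n => by
    have : IsFiniteMeasure (Λ.restrict (annulus x₀ n)) := ⟨by simpa using hfin n⟩
    have : Nonempty S := ⟨x₀⟩
    exact exists_eq_smul_isProbabilityMeasure _
  choose r ν hν hrν using hex
  have hA := measurableSet_annulus x₀
  let P : Measure (ℕ → ℕ × (ℕ → S)) := Measure.infinitePi fun n => mixedBinomial (r n) (ν n)
  let η : (ℕ → ℕ × (ℕ → S)) → PointMeasure S := superpositionPointMeasure x₀
  have hη : ∀ B, MeasurableSet B → (fun ω => (η ω).toMeasure B) =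
      fun ω => ∑' n, (pointCount (B ∩ annulus x₀ n) (ω n) : ℝ≥0∞) := fun B hB =>
    funext fun ω => superposition_apply hA ω hB
  have hm : ∀ B, MeasurableSet B → ∀ n, Measurable fun ω : ℕ → ℕ × (ℕ → S) =>
      pointCount (B ∩ annulus x₀ n) (ω n) := fun B hB n =>
    (measurable_pointCount (hB.inter (hA n))).comp (measurable_pi_apply n)
  have hlaw : ∀ B, MeasurableSet B → ∀ n, P.map (fun ω => pointCount (B ∩ annulus x₀ n) (ω n)) =
      poissonMeasure (Λ (B ∩ annulus x₀ n)).toNNReal := by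
    intro B hB n
    have hc := measurable_pointCount (hB.inter (hA n))
    change P.map (pointCount (B ∩ annulus x₀ n) ∘ fun ω => ω n) = _
    rw [← Measure.map_map hc (measurable_pi_apply n), Measure.infinitePi_map_eval,
      map_pointCount _ _ (hB.inter (hA n)),
      hrν, Measure.restrict_apply (hB.inter (hA n)), Set.inter_assoc, Set.inter_self]
  have hind : ∀ B, MeasurableSet B →
      iIndepFun (fun n (ω : ℕ → ℕ × (ℕ → S)) => pointCount (B ∩ annulus x₀ n) (ω n)) P :=
    fun B hB => iIndepFun_infinitePi fun n => measurable_pointCount (hB.inter (hA n))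
  have hne : ∀ (B : Set S) n, Λ (B ∩ annulus x₀ n) ≠ ∞ := fun B n =>
    ((measure_mono Set.inter_subset_right).trans_lt (hfin n)).ne
  have hcoe : ∀ (B : Set S) m,
      ((∑ n ∈ Finset.range m, (Λ (B ∩ annulus x₀ n)).toNNReal : ℝ≥0) : ℝ≥0∞) =
        ∑ n ∈ Finset.range m, Λ (B ∩ annulus x₀ n) := by
    intro B m
    rw [ENNReal.ofNNReal_finsetSum]
    exact Finset.sum_congr rfl fun n _ => ENNReal.coe_toNNReal (hne B n)
  have htend : ∀ B, MeasurableSet B → Tendsto (fun m =>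
      ((∑ n ∈ Finset.range m, (Λ (B ∩ annulus x₀ n)).toNNReal : ℝ≥0) : ℝ≥0∞)) atTop
        (𝓝 (Λ B)) := by
    intro B hB
    simp_rw [hcoe]
    rw [← tsum_measure_inter_annulus x₀ Λ hB]
    exact ENNReal.tendsto_nat_tsum _
  have hmeas : ∀ B, MeasurableSet B → Measurable fun ω => (η ω).toMeasure B := by
    intro B hB
    rw [hη B hB]
    exact Measurable.tsum fun n =>
      (measurable_of_countable fun n : ℕ => (n : ℝ≥0∞)).comp (hm B hB n)
  refine ⟨P, η, inferInstance, PointMeasure.measurable_of_count hmeas, ?_, ?_, ?_⟩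
  · intro B hB hΛ
    refine ⟨(hmeas B hB).aemeasurable, ?_⟩
    rw [hη B hB]
    refine (hind B hB).map_tsum_poissonMeasure (hm B hB) (hlaw B hB) ?_
    rw [← ENNReal.hasSum_coe, ENNReal.coe_toNNReal hΛ]
    simp_rw [ENNReal.coe_toNNReal (hne B _)]
    rw [← tsum_measure_inter_annulus x₀ Λ hB]
    exact ENNReal.summable.hasSum
  · intro B hB hΛ
    simp_rw [congrFun (hη B hB)]
    refine (hind B hB).tsum_eq_top_of_poissonMeasure (hm B hB) (hlaw B hB) ?_
    have := htend B hB
    rw [hΛ, ENNReal.tendsto_coe_nhds_top] at this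
    exact this
  · intro k B hB hd
    have h1 : iIndepFun (fun n (ω : ℕ → ℕ × (ℕ → S)) =>
        fun i => pointCount (B i ∩ annulus x₀ n) (ω n)) P :=
      iIndepFun_infinitePi (X := fun n p i => pointCount (B i ∩ annulus x₀ n) p) fun n =>
        measurable_pi_lambda _ fun i => measurable_pointCount ((hB i).inter (hA n))
    have h2 : ∀ n, iIndepFun (fun i (ω : ℕ → ℕ × (ℕ → S)) =>
        pointCount (B i ∩ annulus x₀ n) (ω n)) P := by
      intro n
      rw [← iIndepFun_map_iff (measurable_pi_apply n)
        (fun i => measurable_pointCount ((hB i).inter (hA n))), Measure.infinitePi_map_eval]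
      exact iIndepFun_pointCount _ _ (fun i => (hB i).inter (hA n)) fun i j hij =>
        (hd hij).mono Set.inter_subset_left Set.inter_subset_left
    -- Independence across annuli and, within each, across the sets gives independence of the whole
    -- array; regrouping it by sets and summing over annuli gives independence of the total counts.
    have h3 := iIndepFun_uncurry' (fun n i => hm (B i) (hB i) n) h1 h2
    have h4 := iIndepFun_curry (X := fun (i : Fin k) (n : ℕ) (ω : ℕ → ℕ × (ℕ → S)) =>
        pointCount (B i ∩ annulus x₀ n) (ω n)) (fun i n => hm (B i) (hB i) n)
      (h3.precomp (g := fun p : (_ : Fin k) × ℕ => (p.2, p.1)) (by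
        rintro ⟨i, n⟩ ⟨j, m⟩ h
        simp only [Prod.mk.injEq] at h
        rw [h.1, h.2]))
    have h5 := h4.comp (fun _ x => ∑' n, (x n : ℝ≥0∞)) fun _ => Measurable.tsum fun n =>
      (measurable_of_countable fun n : ℕ => (n : ℝ≥0∞)).comp (measurable_pi_apply n)
    convert! h5 using 2 with i
    exact hη _ (hB i)

lemma IsPoissonProcess.map_id {Ω : Type*} [MeasurableSpace Ω] {P : Measure Ω}
    [IsProbabilityMeasure P] {η : Ω → PointMeasure S} {Λ : Measure S}
    (h : IsPoissonProcess η Λ P) : IsPoissonProcess (fun μ => μ) Λ (P.map η) where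
  measurable := measurable_id
  hasLaw_count B hB hΛ := by
    refine ⟨(PointMeasure.measurable_count hB).aemeasurable, ?_⟩
    rw [Measure.map_map (PointMeasure.measurable_count hB) h.measurable,
      ← (h.hasLaw_count B hB hΛ).map_eq]
    rfl
  count_eq_top B hB hΛ := by
    rw [ae_map_iff h.measurable.aemeasurable
      (measurableSet_eq_fun (PointMeasure.measurable_count hB) measurable_const)]
    exact h.count_eq_top B hB hΛ
  iIndepFun_count n B hB hd :=
    (iIndepFun_map_iff h.measurable fun i => PointMeasure.measurable_count (hB i)).2
      (h.iIndepFun_count n B hB hd)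

end Existence

/-! ### The mapping theorem. -/

namespace PointMeasure

variable {S S' : Type*} [TopologicalSpace S] [MeasurableSpace S] [TopologicalSpace S']
  [MeasurableSpace S']

/-- The image under `T` of the restriction of a point measure to `A`. -/
@[simps]
noncomputable def mapOn [OpensMeasurableSpace S'] (T : S → S') (A : Set S) (hT : Measurable T)
    (hA : MeasurableSet A)
    (hc : ∀ x, ∃ U ∈ 𝓝 x, ∃ K, IsCompact K ∧ A ∩ T ⁻¹' U ⊆ K) (μ : PointMeasure S) :
    PointMeasure S' where
  toMeasure := (μ.toMeasure.restrict A).map T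
  locallyFinite := by
    have := μ.locallyFinite
    refine ⟨fun x => ?_⟩
    obtain ⟨U, hU, K, hK, hUK⟩ := hc x
    refine ⟨interior U, interior_mem_nhds.2 hU, ?_⟩
    rw [Measure.map_apply hT isOpen_interior.measurableSet,
      Measure.restrict_apply (hT isOpen_interior.measurableSet), Set.inter_comm]
    exact (measure_mono ((Set.inter_subset_inter_right A
      (Set.preimage_mono interior_subset)).trans hUK)).trans_lt hK.measure_lt_top
  integerValued := fun B hB => by
    rw [Measure.map_apply hT hB, Measure.restrict_apply (hT hB)]
    exact μ.integerValued _ ((hT hB).inter hA)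

end PointMeasure

section Mapping

variable {S S' Ω : Type*} [TopologicalSpace S] [MeasurableSpace S] [MetricSpace S']
  [ProperSpace S'] [MeasurableSpace S'] [BorelSpace S'] [MeasurableSpace Ω] {P : Measure Ω}

/-- The mapping theorem for Poisson processes. -/
theorem IsPoissonProcess.mapOn {η : Ω → PointMeasure S} {Λ : Measure S}
    (h : IsPoissonProcess η Λ P)
    (hcount : ∀ B, MeasurableSet B → Measurable fun ω => (η ω).toMeasure B)
    {T : S → S'} {A : Set S} (hT : Measurable T) (hA : MeasurableSet A)
    (hc : ∀ x, ∃ U ∈ 𝓝 x, ∃ K, IsCompact K ∧ A ∩ T ⁻¹' U ⊆ K) :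
    IsPoissonProcess (fun ω => (η ω).mapOn T A hT hA hc) ((Λ.restrict A).map T) P := by
  have happ : ∀ (M : Measure S) B, MeasurableSet B →
      (M.restrict A).map T B = M (T ⁻¹' B ∩ A) := fun M B hB => by
    rw [Measure.map_apply hT hB, Measure.restrict_apply (hT hB)]
  have hm : ∀ B, MeasurableSet B → MeasurableSet (T ⁻¹' B ∩ A) := fun B hB => (hT hB).inter hA
  refine ⟨PointMeasure.measurable_of_count fun B hB => ?_, fun B hB hΛ => ?_, fun B hB hΛ => ?_,
    fun n B hB hd => ?_⟩
  · simp_rw [PointMeasure.mapOn_toMeasure, happ _ B hB]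
    exact hcount _ (hm B hB)
  · rw [happ _ B hB] at hΛ ⊢
    simp_rw [PointMeasure.mapOn_toMeasure, happ _ B hB]
    exact h.hasLaw_count _ (hm B hB) hΛ
  · rw [happ _ B hB] at hΛ
    simp_rw [PointMeasure.mapOn_toMeasure, happ _ B hB]
    exact h.count_eq_top _ (hm B hB) hΛ
  · simp_rw [PointMeasure.mapOn_toMeasure, happ _ _ (hB _)]
    exact h.iIndepFun_count n _ (fun i => hm _ (hB i)) fun i j hij =>
      ((hd hij).preimage T).mono Set.inter_subset_left Set.inter_subset_left

lemma IsPoissonProcess.ae_count_eq_zero {η : Ω → PointMeasure S} {Λ : Measure S}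
    (h : IsPoissonProcess η Λ P) {B : Set S} (hB : MeasurableSet B) (hΛ : Λ B = 0) :
    ∀ᵐ ω ∂P, (η ω).toMeasure B = 0 := by
  have hl := h.hasLaw_count B hB (by simp [hΛ])
  rw [hΛ, ENNReal.toNNReal_zero] at hl
  rw [hl.ae_iff (p := fun x => x = 0) (measurableSet_setOfPred.1 (measurableSet_singleton 0)),
    ae_map_iff (p := fun x : ℝ≥0∞ => x = 0) (measurable_of_countable _).aemeasurable
      (measurableSet_singleton 0)]
  have : ∀ᵐ n ∂(poissonMeasure 0), n ∈ ({0} : Set ℕ) := by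
    refine (mem_ae_iff_prob_eq_one (measurableSet_singleton 0)).2 ?_
    rw [poissonMeasure_singleton]
    simp
  filter_upwards [this] with n hn
  simpa using hn

end Mapping

/-! ### The vertical change of variables. -/

section HeightScale

/-- The change of heights `u ↦ (u / C) ^ (1 / p)`, the inverse of `h ↦ C h ^ p`. -/
noncomputable def heightScale (C : ℝ≥0) (p : ℝ) (u : ℝ≥0) : ℝ≥0 := (u / C) ^ p⁻¹

lemma measurable_heightScale (C : ℝ≥0) (p : ℝ) : Measurable (heightScale C p) := by
  unfold heightScale
  fun_prop

variable {C : ℝ≥0} {p : ℝ}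

/-- This equivalence is the only access to `heightScale` needed for the image intensity, the local
finiteness and the limit. -/
lemma heightScale_le_iff (hC : 0 < C) (hp : 0 < p) {u x : ℝ≥0} :
    heightScale C p u ≤ x ↔ u ≤ C * x ^ p := by
  rw [heightScale, NNReal.rpow_inv_le_iff hp, div_le_iff₀ hC, mul_comm]

lemma measurableEmbedding_coe_nnreal : MeasurableEmbedding (fun h : ℝ≥0 => (h : ℝ)) :=
  MeasurableEmbedding.subtype_coe measurableSet_Ici

lemma volume_Iic_nnreal (x : ℝ≥0) :
    (volume : Measure ℝ).comap (fun h : ℝ≥0 => (h : ℝ)) (Set.Iic x) = x := by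
  have he := measurableEmbedding_coe_nnreal
  rw [he.comap_apply]
  have : (fun h : ℝ≥0 => (h : ℝ)) '' Set.Iic x = Set.Icc 0 (x : ℝ) := by
    ext y
    constructor
    · rintro ⟨h, hh, rfl⟩
      exact ⟨h.2, by exact_mod_cast hh⟩
    · rintro ⟨h0, hx⟩
      exact ⟨⟨y, h0⟩, hx, rfl⟩
  rw [this, Real.volume_Icc, sub_zero, ENNReal.ofReal_coe_nnreal]

lemma setLIntegral_Iic_nnreal (F : ℝ → ℝ≥0∞) (x : ℝ≥0) :
    ∫⁻ h in Set.Iic x, F (h : ℝ) ∂((volume : Measure ℝ).comap fun h : ℝ≥0 => (h : ℝ)) =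
      ∫⁻ y in Set.Icc 0 (x : ℝ), F y := by
  have he := measurableEmbedding_coe_nnreal
  have hpre : Set.Iic x = (fun h : ℝ≥0 => (h : ℝ)) ⁻¹' Set.Iic (x : ℝ) := by
    ext h; simp
  rw [hpre, ← he.lintegral_map, ← he.restrict_map, he.map_comap,
    Measure.restrict_restrict measurableSet_Iic]
  congr 2
  ext y
  constructor
  · rintro ⟨h0, ⟨h, rfl⟩⟩
    exact ⟨h.2, h0⟩
  · rintro ⟨h0, h1⟩
    exact ⟨h1, ⟨y, h0⟩, rfl⟩

lemma setLIntegral_Icc_rpow {a β : ℝ} (ha : 0 ≤ a) (hβ : -1 < β) (x : ℝ≥0) :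
    ∫⁻ y in Set.Icc 0 (x : ℝ), ENNReal.ofReal (a * y ^ β) =
      ENNReal.ofReal (a / (β + 1) * x ^ (β + 1)) := by
  have hint : IntervalIntegrable (fun y : ℝ => a * y ^ β) volume 0 x :=
    (intervalIntegral.intervalIntegrable_rpow' hβ).const_mul a
  rw [setLIntegral_congr Ioc_ae_eq_Icc.symm, ← ofReal_integral_eq_lintegral_ofReal,
    ← intervalIntegral.integral_of_le x.coe_nonneg, intervalIntegral.integral_const_mul,
    integral_rpow (Or.inl hβ), Real.zero_rpow (by linarith)]
  · congr 1
    ring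
  · exact (intervalIntegrable_iff_integrableOn_Ioc_of_le x.coe_nonneg).1 hint
  · refine (ae_restrict_iff' measurableSet_Ioc).2 (.of_forall fun y hy => ?_)
    exact mul_nonneg ha (Real.rpow_nonneg hy.1.le _)

/-- The scale `a / (β + 1)` comes from `∫_0^x a y^β dy = a / (β + 1) * x ^ (β + 1)`: both measures
give this mass to `Iic x`, and these sets form a generating π-system. -/
lemma map_heightScale {a β : ℝ} (ha : 0 < a) (hβ : -1 < β) :
    ((volume : Measure ℝ).comap (fun h : ℝ≥0 => (h : ℝ))).map
        (heightScale (a / (β + 1)).toNNReal (β + 1)) =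
      ((volume : Measure ℝ).comap (fun h : ℝ≥0 => (h : ℝ))).withDensity
        fun h => ENNReal.ofReal (a * (h : ℝ) ^ β) := by
  have hp : 0 < β + 1 := by linarith
  have hC : 0 < (a / (β + 1)).toNNReal := Real.toNNReal_pos.2 (by positivity)
  have hIic : ∀ x : ℝ≥0, ((volume : Measure ℝ).comap (fun h : ℝ≥0 => (h : ℝ))).map
        (heightScale (a / (β + 1)).toNNReal (β + 1)) (Set.Iic x) =
        ((a / (β + 1)).toNNReal * x ^ (β + 1) : ℝ≥0) := by
    intro x
    rw [Measure.map_apply (measurable_heightScale _ _) measurableSet_Iic,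
      ← volume_Iic_nnreal]
    congr 1
    ext u
    exact heightScale_le_iff hC hp
  refine Measure.ext_of_generateFrom_of_iUnion (Set.range Set.Iic) (fun n : ℕ => Set.Iic (n : ℝ≥0))
    (BorelSpace.measurable_eq.trans (borel_eq_generateFrom_Iic ℝ≥0)) ?_ ?_ (fun n => ⟨_, rfl⟩)
    (fun n => ?_) ?_
  · rintro _ ⟨x, rfl⟩ _ ⟨y, rfl⟩ _
    exact ⟨x ⊓ y, Set.Iic_inter_Iic.symm⟩
  · refine Set.eq_univ_of_forall fun x => ?_
    obtain ⟨n, hn⟩ := exists_nat_ge x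
    exact Set.mem_iUnion.2 ⟨n, hn⟩
  · rw [hIic]
    exact ENNReal.coe_ne_top
  · rintro _ ⟨x, rfl⟩
    rw [hIic, withDensity_apply _ measurableSet_Iic,
      setLIntegral_Iic_nnreal (fun y => ENNReal.ofReal (a * y ^ β)) x,
      setLIntegral_Icc_rpow ha.le hβ, ENNReal.ofReal_mul (by positivity)]
    rw [ENNReal.coe_mul, ← NNReal.coe_rpow, ENNReal.ofReal_coe_nnreal]
    rfl

end HeightScale

section HeightMap

variable {d : ℕ}

/-- The hypothesis is a properness condition on `g` over `A`: bounded image heights come from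
bounded heights. It prevents points from accumulating under the map. -/
lemma exists_isCompact_heightMap {g : ℝ≥0 → ℝ≥0} {A : Set ℝ≥0}
    (h : ∀ M, ∃ R, ∀ u ∈ A, g u ≤ M → u ≤ R) (x : HalfSpace d) :
    ∃ U ∈ 𝓝 x, ∃ K : Set (HalfSpace d), IsCompact K ∧
      (Set.univ ×ˢ A) ∩ (Prod.map id g) ⁻¹' U ⊆ K := by
  obtain ⟨R, hR⟩ := h (x.2 + 1)
  refine ⟨Metric.closedBall x.1 1 ×ˢ Set.Iic (x.2 + 1),
    prod_mem_nhds (Metric.closedBall_mem_nhds _ one_pos)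
      (Iic_mem_nhds (lt_add_of_pos_right _ one_pos)),
    Metric.closedBall x.1 1 ×ˢ Set.Icc 0 R, (isCompact_closedBall _ _).prod isCompact_Icc, ?_⟩
  rintro ⟨v, u⟩ ⟨⟨-, hu⟩, hv, hg⟩
  exact ⟨hv, zero_le, hR u hu hg⟩

/-- Move the points of a point measure vertically by `g`, keeping those with height in `A`. -/
noncomputable def heightMap (g : ℝ≥0 → ℝ≥0) (A : Set ℝ≥0) (hg : Measurable g)
    (hA : MeasurableSet A) (h : ∀ M, ∃ R, ∀ u ∈ A, g u ≤ M → u ≤ R) :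
    PointMeasure (HalfSpace d) → PointMeasure (HalfSpace d) :=
  PointMeasure.mapOn (Prod.map id g) (Set.univ ×ˢ A) (measurable_id.prodMap hg)
    (MeasurableSet.univ.prod hA) (exists_isCompact_heightMap h)

lemma lintegral_heightMap {g : ℝ≥0 → ℝ≥0} {A : Set ℝ≥0} (hg : Measurable g)
    (hA : MeasurableSet A) (h : ∀ M, ∃ R, ∀ u ∈ A, g u ≤ M → u ≤ R)
    (μ : PointMeasure (HalfSpace d)) (f : CompactlySupportedContinuousMap (HalfSpace d) ℝ≥0) :
    ∫⁻ x, (f x : ℝ≥0∞) ∂(heightMap g A hg hA h μ).toMeasure =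
      ∫⁻ x, (Set.univ ×ˢ A).indicator (fun x => (f (x.1, g x.2) : ℝ≥0∞)) x ∂μ.toMeasure := by
  rw [heightMap, PointMeasure.mapOn_toMeasure, lintegral_map
    (PointMeasure.measurable_coe_testFunction f) (measurable_id.prodMap hg),
    lintegral_indicator (MeasurableSet.univ.prod hA)]
  rfl

instance : IsLocallyFiniteMeasure ((volume : Measure ℝ).comap fun h : ℝ≥0 => (h : ℝ)) :=
  ⟨fun x => ⟨Set.Iic (x + 1), Iic_mem_nhds (lt_add_of_pos_right _ one_pos), by
    rw [volume_Iic_nnreal]; exact ENNReal.coe_lt_top⟩⟩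

instance : IsLocallyFiniteMeasure (lebesgueHalfSpace d) := by
  unfold lebesgueHalfSpace; infer_instance

lemma map_lebesgueHalfSpace {g : ℝ≥0 → ℝ≥0} (hg : Measurable g) (A : Set ℝ≥0) :
    ((lebesgueHalfSpace d).restrict (Set.univ ×ˢ A)).map (Prod.map id g) =
      (volume : Measure (EuclideanSpace ℝ (Fin d))).prod
        ((((volume : Measure ℝ).comap fun h : ℝ≥0 => (h : ℝ)).restrict A).map g) := by
  rw [lebesgueHalfSpace, ← Measure.prod_restrict, Measure.restrict_univ,
    ← Measure.map_prod_map _ _ measurable_id hg, Measure.map_id]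

lemma map_lebesgueHalfSpace_heightScale {β γ : ℝ} (hγ : 0 < γ * betaConst d β) (hβ : -1 < β) :
    ((lebesgueHalfSpace d).restrict (Set.univ ×ˢ Set.univ)).map
      (Prod.map id (heightScale (γ * betaConst d β / (β + 1)).toNNReal (β + 1))) =
      betaIntensity d β γ := by
  rw [map_lebesgueHalfSpace (measurable_heightScale _ _), Measure.restrict_univ,
    map_heightScale hγ hβ, prod_withDensity_right (by fun_prop)]
  rfl

lemma map_lebesgueHalfSpace_zero (γ : ℝ) :
    ((lebesgueHalfSpace d).restrict (Set.univ ×ˢ Set.Iio (rConst d * γ).toNNReal)).map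
      (Prod.map id fun _ => 0) = limitIntensity d γ := by
  have hIio : (volume : Measure ℝ).comap (fun h : ℝ≥0 => (h : ℝ))
      (Set.Iio (rConst d * γ).toNNReal) = ENNReal.ofReal (rConst d * γ) := by
    have : NullSingletonClass ((volume : Measure ℝ).comap fun h : ℝ≥0 => (h : ℝ)) := by
      refine ⟨fun x => ?_⟩
      rw [measurableEmbedding_coe_nnreal.comap_apply]
      simp
    rw [measure_congr Iio_ae_eq_Iic, volume_Iic_nnreal]
    rfl
  rw [map_lebesgueHalfSpace measurable_const, Measure.map_const,
    Measure.restrict_apply MeasurableSet.univ, Set.univ_inter, hIio, Measure.prod_smul_right,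
    Measure.prod_dirac]
  rfl

end HeightMap

/-! ### The limit of the scaling constants. -/

section Constants

lemma betaConst_pos (d : ℕ) {β : ℝ} (hβ : -1 < β) : 0 < betaConst d β := by
  have h1 : 0 < ((d : ℝ) + 1) / 2 + β + 1 := by
    have : (0 : ℝ) ≤ d := d.cast_nonneg
    linarith
  have h2 : 0 < β + 1 := by linarith
  exact div_pos (Real.Gamma_pos_of_pos h1)
    (mul_pos (Real.rpow_pos_of_pos Real.pi_pos _) (Real.Gamma_pos_of_pos h2))

/-- The factor `β + 1` is absorbed by `Γ(β + 1) (β + 1) = Γ(β + 2)`, which removes the pole and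
leaves a function continuous at `-1`. -/
lemma tendsto_betaConst_div (d : ℕ) (γ : ℝ) :
    Tendsto (fun β : ℝ => γ * betaConst d β / (β + 1)) (𝓝[>] (-1)) (𝓝 (rConst d * γ)) := by
  have hpi : (0 : ℝ) < Real.pi ^ (((d : ℝ) + 1) / 2) := Real.rpow_pos_of_pos Real.pi_pos _
  have hG : ∀ s : ℝ, 0 < s → ContinuousAt Real.Gamma s := fun s hs =>
    (Real.differentiableAt_Gamma fun m => by
      have : (0 : ℝ) ≤ m := m.cast_nonneg
      linarith).continuousAt
  have hc : Tendsto (fun β : ℝ => γ * (Real.Gamma (((d : ℝ) + 1) / 2 + β + 1) /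
      (Real.pi ^ (((d : ℝ) + 1) / 2) * Real.Gamma (β + 1 + 1)))) (𝓝 (-1))
      (𝓝 (γ * (Real.Gamma (((d : ℝ) + 1) / 2) /
        (Real.pi ^ (((d : ℝ) + 1) / 2) * Real.Gamma 1)))) := by
    have t1 : Tendsto (fun β : ℝ => ((d : ℝ) + 1) / 2 + β + 1) (𝓝 (-1))
        (𝓝 (((d : ℝ) + 1) / 2)) := by
      have : Continuous fun β : ℝ => ((d : ℝ) + 1) / 2 + β + 1 := by fun_prop
      simpa using this.tendsto (-1)
    have t2 : Tendsto (fun β : ℝ => β + 1 + 1) (𝓝 (-1)) (𝓝 1) := by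
      have : Continuous fun β : ℝ => β + 1 + 1 := by fun_prop
      simpa using this.tendsto (-1)
    have g1 := (hG (((d : ℝ) + 1) / 2) (by positivity)).tendsto.comp t1
    have g2 := (hG 1 one_pos).tendsto.comp t2
    refine (g1.div (g2.const_mul _) ?_).const_mul γ
    rw [Real.Gamma_one]
    positivity
  have hlim : γ * (Real.Gamma (((d : ℝ) + 1) / 2) /
        (Real.pi ^ (((d : ℝ) + 1) / 2) * Real.Gamma 1)) = rConst d * γ := by
    rw [rConst, Real.Gamma_one, Real.rpow_neg Real.pi_pos.le]
    field_simp
  rw [hlim] at hc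
  refine (hc.mono_left nhdsWithin_le_nhds).congr' ?_
  filter_upwards [self_mem_nhdsWithin] with β hβ
  have hβ' : (0 : ℝ) < β + 1 := by
    have : (-1 : ℝ) < β := hβ
    linarith
  rw [Real.Gamma_add_one hβ'.ne', betaConst]
  have := (Real.Gamma_pos_of_pos hβ').ne'
  field_simp

end Constants

/-! ### Almost sure convergence of the coupled processes. -/

section Convergence

variable {d : ℕ} {ι : Type*} {l : Filter ι} {C : ι → ℝ≥0} {p : ι → ℝ} {c : ℝ≥0}

/-- Positivity of `x` matters: `0 ^ p = 0` for every `p > 0`, whereas `0 ^ 0 = 1`. -/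
lemma tendsto_mul_rpow (hC : Tendsto C l (𝓝 c)) (hp : Tendsto p l (𝓝 0)) {x : ℝ≥0} (hx : 0 < x) :
    Tendsto (fun i => C i * x ^ p i) l (𝓝 c) := by
  have h : Tendsto (fun i => x ^ p i) l (𝓝 (x ^ (0 : ℝ))) :=
    tendsto_const_nhds.nnrpow hp (Or.inl hx.ne')
  rw [NNReal.rpow_zero] at h
  simpa using hC.mul h

lemma tendsto_heightScale_zero (hC : Tendsto C l (𝓝 c)) (hp : Tendsto p l (𝓝 0))
    (hC0 : ∀ i, 0 < C i) (hp0 : ∀ i, 0 < p i) {u : ℝ≥0} (hu : u < c) :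
    Tendsto (fun i => heightScale (C i) (p i) u) l (𝓝 0) := by
  refine tendsto_order.2 ⟨fun a ha => absurd ha not_lt_zero, fun ε hε => ?_⟩
  filter_upwards [(tendsto_mul_rpow hC hp (half_pos hε)).eventually_const_lt hu] with i hi
  exact ((heightScale_le_iff (hC0 i) (hp0 i)).2 hi.le).trans_lt (NNReal.half_lt_self hε.ne')

/-- As `p → 0` and `C → c`, the points below height `c` fall to height `0` and those above
escape to infinity. -/
lemma tendsto_heightMap [l.IsCountablyGenerated] (hC : Tendsto C l (𝓝 c))
    (hp : Tendsto p l (𝓝 0)) (hC0 : ∀ i, 0 < C i) (hp0 : ∀ i, 0 < p i)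
    (h : ∀ i M, ∃ R, ∀ u ∈ Set.univ, heightScale (C i) (p i) u ≤ M → u ≤ R)
    (h' : ∀ M : ℝ≥0, ∃ R, ∀ u ∈ Set.Iio c, (fun _ => 0 : ℝ≥0 → ℝ≥0) u ≤ M → u ≤ R)
    {μ : PointMeasure (HalfSpace d)} (hμ : μ.toMeasure (Set.univ ×ˢ {c}) = 0) :
    Tendsto (fun i => heightMap (heightScale (C i) (p i)) Set.univ
        (measurable_heightScale _ _) MeasurableSet.univ (h i) μ) l
      (𝓝 (heightMap (fun _ => 0) (Set.Iio c) measurable_const measurableSet_Iio h' μ)) := by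
  have := μ.locallyFinite
  refine PointMeasure.tendsto_nhds_iff.2 fun f => ?_
  simp_rw [lintegral_heightMap]
  obtain ⟨M, hM⟩ : ∃ M : ℝ≥0, ∀ x, f x ≤ M := by
    obtain ⟨M, hM⟩ := (f.hasCompactSupport.isCompact_range f.continuous).bddAbove
    exact ⟨M, fun x => hM ⟨x, rfl⟩⟩
  obtain ⟨R, hR0, hR⟩ : ∃ R : ℝ≥0, 0 < R ∧
      ∀ v u, f (v, u) ≠ 0 → v ∈ Metric.closedBall (0 : EuclideanSpace ℝ (Fin d)) R ∧ u ≤ R := by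
    obtain ⟨r, hr⟩ := f.hasCompactSupport.isCompact.isBounded.subset_closedBall (0 : HalfSpace d)
    refine ⟨r.toNNReal + 1, by positivity, fun v u hvu => ?_⟩
    have hb := Metric.mem_closedBall.1 (hr (subset_tsupport _ hvu))
    rw [Prod.dist_eq, max_le_iff] at hb
    have hr' : r ≤ r.toNNReal + 1 := (Real.le_coe_toNNReal r).trans (by simp)
    refine ⟨Metric.mem_closedBall.2 ?_, ?_⟩
    · push_cast
      exact hb.1.trans hr'
    · rw [← NNReal.coe_le_coe]
      push_cast
      have h2 := hb.2
      rw [NNReal.dist_eq] at h2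
      exact ((le_abs_self _).trans (by simpa using h2)).trans hr'
  have hlim := tendsto_mul_rpow hC hp hR0
  -- A point moved into the support of `f` started at height at most `C R ^ p`, which tends to `c`
  -- and so is eventually below `c + 1`; `K` therefore carries a common dominating function.
  let K : Set (HalfSpace d) := Metric.closedBall 0 R ×ˢ Set.Icc 0 (c + 1)
  have hK : IsCompact K := (isCompact_closedBall _ _).prod isCompact_Icc
  have hm : ∀ g : ℝ≥0 → ℝ≥0, Measurable g →
      Measurable fun x : HalfSpace d => (f (x.1, g x.2) : ℝ≥0∞) := fun g hg =>
    (PointMeasure.measurable_coe_testFunction f).comp (measurable_id.prodMap hg)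
  refine tendsto_lintegral_filter_of_dominated_convergence (K.indicator fun _ => (M : ℝ≥0∞))
    (.of_forall fun i => (hm _ (measurable_heightScale _ _)).indicator
      (MeasurableSet.univ.prod MeasurableSet.univ)) ?_ ?_ ?_
  · filter_upwards [hlim.eventually_le_const (lt_add_of_pos_right c one_pos)] with i hi
    refine .of_forall fun x => ?_
    rw [Set.univ_prod_univ, Set.indicator_univ]
    by_cases h0 : f (x.1, heightScale (C i) (p i) x.2) = 0
    · simp [h0]
    · obtain ⟨h1, h2⟩ := hR _ _ h0
      have hx : x ∈ K := ⟨h1, zero_le, ((heightScale_le_iff (hC0 i) (hp0 i)).1 h2).trans hi⟩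
      rw [Set.indicator_of_mem hx]
      exact_mod_cast hM _
  · rw [lintegral_indicator_const hK.measurableSet]
    exact (ENNReal.mul_lt_top ENNReal.coe_lt_top hK.measure_lt_top).ne
  · have hae : ∀ᵐ x ∂μ.toMeasure, x.2 ≠ c := by
      rw [ae_iff]
      refine measure_mono_null (fun x hx => ?_) hμ
      exact ⟨Set.mem_univ _, not_not.1 hx⟩
    filter_upwards [hae] with x hx
    rw [Set.univ_prod_univ]
    simp only [Set.indicator_univ]
    rcases lt_or_gt_of_ne hx with hlt | hgt
    · rw [Set.indicator_of_mem (show x ∈ Set.univ ×ˢ Set.Iio c from ⟨Set.mem_univ _, hlt⟩)]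
      refine ENNReal.tendsto_coe.2 ((f.continuous.tendsto (x.1, 0)).comp ?_)
      exact tendsto_const_nhds.prodMk_nhds (tendsto_heightScale_zero hC hp hC0 hp0 hlt)
    -- Above `c`, eventually `C R ^ p < u`, so the moved point lies higher than `R`, outside the
    -- support of `f`.
    · rw [Set.indicator_of_notMem fun hx' => (not_lt.2 hgt.le) hx'.2]
      refine tendsto_const_nhds.congr' ?_
      filter_upwards [hlim.eventually_lt_const hgt] with i hi
      by_contra h0
      refine absurd ((heightScale_le_iff (hC0 i) (hp0 i)).1 (hR x.1 _ fun h1 => h0 ?_).2)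
        (not_le.2 hi)
      simp [h1]

end Convergence

/-- Convergence in distribution depends only on the laws, so it may be checked on copies over one
probability space, where dominated convergence applies to each bounded continuous function. -/
lemma tendstoInDistribution_of_forall_ae_tendsto {ι E Ω' : Type*} {Ω : ι → Type*}
    [TopologicalSpace E] [MeasurableSpace E] [BorelSpace E] [∀ i, MeasurableSpace (Ω i)]
    [MeasurableSpace Ω'] {P : ∀ i, Measure (Ω i)} [∀ i, IsProbabilityMeasure (P i)]
    {P' : Measure Ω'} [IsProbabilityMeasure P'] {X : ∀ i, Ω i → E} {Z : Ω' → E}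
    (hX : ∀ i, Measurable (X i)) (hZ : Measurable Z) {l : Filter ι} [l.IsCountablyGenerated]
    {Ω₀ : Type*} [MeasurableSpace Ω₀] {P₀ : Measure Ω₀} [IsProbabilityMeasure P₀]
    {Y : ι → Ω₀ → E} {W : Ω₀ → E} (hY : ∀ i, Measurable (Y i)) (hW : Measurable W)
    (hXY : ∀ i, (P i).map (X i) = P₀.map (Y i)) (hZW : P'.map Z = P₀.map W)
    (h : ∀ᵐ ω ∂P₀, Tendsto (fun i => Y i ω) l (𝓝 (W ω))) :
    TendstoInDistribution X l Z P P' := by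
  refine ⟨fun i => (hX i).aemeasurable, hZ.aemeasurable, ?_⟩
  refine ProbabilityMeasure.tendsto_iff_forall_integral_tendsto.2 fun F => ?_
  change Tendsto (fun i => ∫ x, F x ∂((P i).map (X i))) l (𝓝 (∫ x, F x ∂(P'.map Z)))
  simp_rw [hXY, hZW]
  have hF := F.continuous.measurable
  rw [integral_map hW.aemeasurable hF.aestronglyMeasurable]
  simp_rw [fun i => integral_map (hY i).aemeasurable (hF.aestronglyMeasurable (μ := P₀.map (Y i)))]
  refine tendsto_integral_filter_of_dominated_convergence (fun _ => ‖F‖)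
    (.of_forall fun i => (hF.comp (hY i)).aestronglyMeasurable)
    (.of_forall fun i => .of_forall fun ω => F.norm_coe_le_norm _) (integrable_const _) ?_
  filter_upwards [h] with ω hω
  exact (F.continuous.tendsto _).comp hω

lemma lebesgueHalfSpace_height_eq_zero (d : ℕ) (c : ℝ≥0) :
    lebesgueHalfSpace d (Set.univ ×ˢ {c}) = 0 := by
  rw [lebesgueHalfSpace, Measure.prod_prod, measurableEmbedding_coe_nnreal.comap_apply]
  simp

lemma forall_exists_heightScale_le {C : ℝ≥0} {p : ℝ} (hC : 0 < C) (hp : 0 < p) (M : ℝ≥0) :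
    ∃ R, ∀ u ∈ Set.univ, heightScale C p u ≤ M → u ≤ R :=
  ⟨C * M ^ p, fun _ _ hu => (heightScale_le_iff hC hp).1 hu⟩

theorem mainTheorem10 (d : ℕ) (γ : ℝ) (hγ : 0 < γ) :
    -- the Poisson processes in question exist
    (∀ β : ℝ, -1 < β → ∃ Q : ProbabilityMeasure (PointMeasure (HalfSpace d)),
      IsPoissonProcess (fun μ => μ) (betaIntensity d β γ) (Q : Measure _)) ∧
    (∃ Q : ProbabilityMeasure (PointMeasure (HalfSpace d)),
      IsPoissonProcess (fun μ => μ) (limitIntensity d γ) (Q : Measure _)) ∧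
    -- and, however they are realized, they converge in distribution as `β ↓ -1`
    (∀ (Ω : Set.Ioi (-1 : ℝ) → Type*) [∀ β, MeasurableSpace (Ω β)]
      (P : ∀ β, Measure (Ω β)) [∀ β, IsProbabilityMeasure (P β)]
      (η : ∀ β, Ω β → PointMeasure (HalfSpace d))
      (Ω' : Type*) [MeasurableSpace Ω'] (P' : Measure Ω') [IsProbabilityMeasure P']
      (η' : Ω' → PointMeasure (HalfSpace d)),
      (∀ β, IsPoissonProcess (η β) (betaIntensity d β γ) (P β)) →
      IsPoissonProcess η' (limitIntensity d γ) P' →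
      TendstoInDistribution η (comap (fun β : Set.Ioi (-1 : ℝ) => (β : ℝ)) (𝓝[>] (-1)))
        η' P P') := by
  obtain ⟨P₀, N, hP₀, hN⟩ := exists_isPoissonProcess (lebesgueHalfSpace d)
  let C : Set.Ioi (-1 : ℝ) → ℝ≥0 := fun β => (γ * betaConst d β / (β + 1)).toNNReal
  let p : Set.Ioi (-1 : ℝ) → ℝ := fun β => β + 1
  let c : ℝ≥0 := (rConst d * γ).toNNReal
  have hp0 : ∀ β, 0 < p β := fun β => by
    have : (-1 : ℝ) < β := β.2
    simp only [p]
    linarith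
  have hγβ : ∀ β : Set.Ioi (-1 : ℝ), 0 < γ * betaConst d β := fun β =>
    mul_pos hγ (betaConst_pos d β.2)
  have hC0 : ∀ β, 0 < C β := fun β => Real.toNNReal_pos.2 (div_pos (hγβ β) (hp0 β))
  have h := fun β => forall_exists_heightScale_le (hC0 β) (hp0 β)
  have h' : ∀ M : ℝ≥0, ∃ R, ∀ u ∈ Set.Iio c, (fun _ => 0 : ℝ≥0 → ℝ≥0) u ≤ M → u ≤ R :=
    fun M => ⟨c, fun u hu _ => hu.le⟩
  -- The coupling: every `Y β` and the limit `W` are functions of the same `N`.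
  let Y : Set.Ioi (-1 : ℝ) → _ → PointMeasure (HalfSpace d) := fun β ω =>
    heightMap (heightScale (C β) (p β)) Set.univ (measurable_heightScale _ _)
      MeasurableSet.univ (h β) (N ω)
  let W : _ → PointMeasure (HalfSpace d) := fun ω =>
    heightMap (fun _ => 0) (Set.Iio c) measurable_const measurableSet_Iio h' (N ω)
  have hNc := fun B hB => hN.measurable_count (B := B) hB
  have hY : ∀ β : Set.Ioi (-1 : ℝ), IsPoissonProcess (Y β) (betaIntensity d β γ) P₀ := by
    intro β
    rw [← map_lebesgueHalfSpace_heightScale (hγβ β) β.2]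
    exact hN.mapOn hNc _ _ _
  have hW : IsPoissonProcess W (limitIntensity d γ) P₀ := by
    rw [← map_lebesgueHalfSpace_zero]
    exact hN.mapOn hNc _ _ _
  refine ⟨fun β hβ => ⟨⟨P₀.map (Y ⟨β, hβ⟩), Measure.isProbabilityMeasure_map
    (hY ⟨β, hβ⟩).measurable.aemeasurable⟩, (hY ⟨β, hβ⟩).map_id⟩,
    ⟨⟨P₀.map W, Measure.isProbabilityMeasure_map hW.measurable.aemeasurable⟩, hW.map_id⟩, ?_⟩
  intro Ω _ P _ η Ω' _ P' _ η' hη hη'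
  refine tendstoInDistribution_of_forall_ae_tendsto (fun β => (hη β).measurable) hη'.measurable
    (fun β => (hY β).measurable) hW.measurable (fun β => (hη β).map_eq (hY β)) (hη'.map_eq hW) ?_
  have hC : Tendsto C (comap (fun β : Set.Ioi (-1 : ℝ) => (β : ℝ)) (𝓝[>] (-1))) (𝓝 c) :=
    (continuous_real_toNNReal.tendsto _).comp ((tendsto_betaConst_div d γ).comp tendsto_comap)
  have hp : Tendsto p (comap (fun β : Set.Ioi (-1 : ℝ) => (β : ℝ)) (𝓝[>] (-1))) (𝓝 0) := by
    have h1 : Tendsto (fun β : ℝ => β + 1) (𝓝 (-1)) (𝓝 0) := by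
      have : Continuous fun β : ℝ => β + 1 := by fun_prop
      simpa using this.tendsto (-1)
    exact (h1.mono_left nhdsWithin_le_nhds).comp tendsto_comap
  -- The exceptional event, a point of `N` at height exactly `c`, does not depend on `β`.
  filter_upwards [hN.ae_count_eq_zero (MeasurableSet.univ.prod (measurableSet_singleton c))
    (lebesgueHalfSpace_height_eq_zero d c)] with ω hω
  exact tendsto_heightMap hC hp hC0 hp0 h h' hω
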